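/- Let $u=(u_i)_{i\in\mathbb Z}\in\{0,1\}^{\mathbb Z}$ be a bi-infinite Sturmian sequence, i.e. for every $n\ge 1$ exactly $n+1$ words of length $n$ occur in $u$, and $u$ is not eventually periodic (there are no integers $p>0$ and $N$ with $u_{i+p}=u_i$ for all $|i|\ge N$). Let $f$ be the left shift $(f(x))_i=x_{i+1}$ on $X_u=\overline{\{f^k(u):k\in\mathbb Z\}}\subset\{0,1\}^{\mathbb Z}$, with the metric $d(x,y)=2^{-k}$, $k=\inf\{i\ge 0: x_i\ne y_i\text{ or }x_{-i}\ne y_{-i}\}$ for $x\neq y$, and $d(x,x)=0$. Then $(X_u,f)$ has exactly one $f$-invariant Borel probability measure $\mu$, and for the polynomial scale $a_\chi(n)=n^\chi$ ($\chi\ge 0$) $$0=h_{\mu,a_\chi}(f)<h_{\mathrm{semitop},\mu,a_\chi}(f)=h_{\mathrm{top},a_\chi}(f)=1 .$$ Here, for a family $N(\epsilon,n)\in[0,\infty]$ put $$h[N]=\lim_{\epsilon\to0^+}\ \sup\Big\{\chi\ge 0:\ \limsup_{n\to\infty}\frac{N(\epsilon,n)}{a_\chi(n)}>0\Big\}\in[0,\infty],\qquad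 \sup\emptyset=0,$$ and let $B^n_f(x,\epsilon)=\{y: d(f^ix,f^iy)<\epsilon\text{ for }0\le i<n\}$ be the Bowen balls. The slow topological entropy is $h_{\mathrm{top},a_\chi}(f)=\sup_K h[N_K]$, the supremum being over compact sets $K\subset X_u$, where $N_K(\epsilon,n)$ is the minimal number of Bowen balls $B^n_f(x,\epsilon)$ covering $K$. The semi-topological slow entropy is $h_{\mathrm{semitop},\mu,a_\chi}(f)=h[S]$, where $S(\epsilon,n)$ is the minimal cardinality of a finite set $F\subset X_u$ with $\mu\big(\bigcup_{x\in F}B^n_f(x,\epsilon)\big)>1-\epsilon$. The slow metric entropy is $h_{\mu,a_\chi}(f)=\sup_{\mathcal P}h[S_{\mathcal P}]$, the supremum being over finite measurable partitions $\mathcal P$ of $X_u$, where $S_{\mathcal P}(\epsilon,n)$ is the minimal cardinality of a finite set $F\subset X_u$ with $\mu\big(\bigcup_{x\in F}\{y:\bar d^n_{\mathcal P}(x,y)<\epsilon\}\big)>1-\epsilon$, and $\bar d^n_{\mathcal P}(x,y)$ is the proportion of times $0\le s<n$ at which $f^sx$ and $f^sy$ lie in different atoms of $\mathcal P$. -/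

import Mathlib

open Set Filter Topology MeasureTheory
open scoped NNReal ENNReal

noncomputable section

namespace SlowEntropy

/-! ### Scales and growth exponents -/

/-- The polynomial scale `a_χ(n) = n ^ χ`, `χ ≥ 0`. -/
def polynomialScale (χ : ℝ≥0) (n : ℕ) : ℝ := (n : ℝ) ^ (χ : ℝ)

/-- `sup {χ ≥ 0 : limsup_{n → ∞} N n / a_χ n > 0}` in `[0, ∞]`; the supremum of the empty set
is `0`. -/
def growthExponent (a : ℝ≥0 → ℕ → ℝ) (N : ℕ → ℝ≥0∞) : ℝ≥0∞ :=
  ⨆ (χ : ℝ≥0) (_ : 0 < limsup (fun n => N n / ENNReal.ofReal (a χ n)) atTop), (χ : ℝ≥0∞)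

/-- The limit as `ε → 0⁺` of the growth exponents of `n ↦ N ε n`. It is written as an upper limit,
which is a limit whenever `N ε n` is nonincreasing in `ε`
(see `tendsto_limitGrowthExponent`). -/
def limitGrowthExponent (a : ℝ≥0 → ℕ → ℝ) (N : ℝ → ℕ → ℝ≥0∞) : ℝ≥0∞ :=
  limsup (fun ε => growthExponent a (N ε)) (𝓝[>] (0 : ℝ))

theorem growthExponent_mono (a : ℝ≥0 → ℕ → ℝ) : Monotone (growthExponent a) := by
  intro M N h
  refine biSup_mono fun χ hχ => lt_of_lt_of_le hχ ?_
  exact limsup_le_limsup (Eventually.of_forall fun n => ENNReal.div_le_div_right (h n) _)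

theorem tendsto_limitGrowthExponent (a : ℝ≥0 → ℕ → ℝ) (N : ℝ → ℕ → ℝ≥0∞) (hN : Antitone N) :
    Tendsto (fun ε => growthExponent a (N ε)) (𝓝[>] (0 : ℝ)) (𝓝 (limitGrowthExponent a N)) := by
  have h : Monotone (fun ε => OrderDual.toDual (growthExponent a (N ε))) :=
    fun _ _ hε => growthExponent_mono a (hN hε)
  have h2 : Tendsto (fun ε => growthExponent a (N ε)) (𝓝[>] (0 : ℝ)) _ := h.tendsto_nhdsGT 0
  rw [limitGrowthExponent, h2.limsup_eq]
  exact h2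

/-! ### Topological, metric and semi-topological slow entropy -/

/-- The `(ε, n)`-Bowen ball centred at `x`. -/
def bowenBall {X : Type*} [MetricSpace X] (f : X → X) (n : ℕ) (x : X) (ε : ℝ) : Set X :=
  {y | ∀ i < n, dist (f^[i] x) (f^[i] y) < ε}

/-- The minimal number of `(ε, n)`-Bowen balls needed to cover `K`. -/
def coverNumber {X : Type*} [MetricSpace X] (f : X → X) (K : Set X) (ε : ℝ) (n : ℕ) : ℝ≥0∞ :=
  ⨅ (F : Finset X) (_ : K ⊆ ⋃ x ∈ F, bowenBall f n x ε), (F.card : ℝ≥0∞)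

/-- The slow topological entropy of `f` for the scale `a`. -/
def topSlowEntropy {X : Type*} [MetricSpace X] (a : ℝ≥0 → ℕ → ℝ) (f : X → X) : ℝ≥0∞ :=
  ⨆ (K : Set X) (_ : IsCompact K), limitGrowthExponent a (coverNumber f K)

/-- The minimal number of `(ε, n)`-Bowen balls whose union has measure greater than `1 - ε`. -/
def semitopNumber {X : Type*} [MetricSpace X] [MeasurableSpace X] (μ : Measure X) (f : X → X)
    (ε : ℝ) (n : ℕ) : ℝ≥0∞ :=
  ⨅ (F : Finset X) (_ : 1 - ε < μ.real (⋃ x ∈ F, bowenBall f n x ε)), (F.card : ℝ≥0∞)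

/-- The semi-topological slow entropy of `f` with respect to the probability measure `μ`. -/
def semitopSlowEntropy {X : Type*} [MetricSpace X] [MeasurableSpace X] (a : ℝ≥0 → ℕ → ℝ)
    (μ : Measure X) (f : X → X) : ℝ≥0∞ :=
  limitGrowthExponent a (semitopNumber μ f)

/-- The `n`-th Hamming distance with respect to a finite partition. The partition into the atoms
`P ⁻¹' {j}`, `j < k`, is given by the function `P`. -/
def hammingDistance {X : Type*} {k : ℕ} (f : X → X) (P : X → Fin k) (n : ℕ) (x y : X) : ℝ :=
  1 - ((Finset.range n).filter fun s => P (f^[s] x) = P (f^[s] y)).card / (n : ℝ)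

/-- The minimal number of `(ε, n)`-Hamming balls whose union has measure greater than `1 - ε`. -/
def hammingNumber {X : Type*} [MeasurableSpace X] {k : ℕ} (μ : Measure X) (f : X → X)
    (P : X → Fin k) (ε : ℝ) (n : ℕ) : ℝ≥0∞ :=
  ⨅ (F : Finset X) (_ : 1 - ε < μ.real (⋃ x ∈ F, {y | hammingDistance f P n x y < ε})),
    (F.card : ℝ≥0∞)

/-- The slow metric entropy of `f` with respect to the probability measure `μ`: the supremum over
all finite measurable partitions of the slow entropy of the partition. -/
def metricSlowEntropy {X : Type*} [MeasurableSpace X] (a : ℝ≥0 → ℕ → ℝ) (μ : Measure X)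
    (f : X → X) : ℝ≥0∞ :=
  ⨆ (k : ℕ) (P : X → Fin k) (_ : Measurable P), limitGrowthExponent a (hammingNumber μ f P)

theorem antitone_coverNumber {X : Type*} [MetricSpace X] (f : X → X) (K : Set X) :
    Antitone (coverNumber f K) := by
  intro ε ε' h n
  refine biInf_mono fun F hF => hF.trans (iUnion₂_mono fun x _ y hy i hi => ?_)
  exact (hy i hi).trans_le h

theorem antitone_semitopNumber {X : Type*} [MetricSpace X] [MeasurableSpace X] (μ : Measure X)
    [IsFiniteMeasure μ] (f : X → X) : Antitone (semitopNumber μ f) := by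
  intro ε ε' h n
  refine biInf_mono fun F hF => lt_of_le_of_lt (sub_le_sub_left h 1) (lt_of_lt_of_le hF ?_)
  exact measureReal_mono (iUnion₂_mono fun x _ y hy i hi => (hy i hi).trans_le h) (measure_ne_top μ _)

theorem antitone_hammingNumber {X : Type*} [MeasurableSpace X] {k : ℕ} (μ : Measure X)
    [IsFiniteMeasure μ] (f : X → X) (P : X → Fin k) : Antitone (hammingNumber μ f P) := by
  intro ε ε' h n
  refine biInf_mono fun F hF => lt_of_le_of_lt (sub_le_sub_left h 1) (lt_of_lt_of_le hF ?_)
  exact measureReal_mono (iUnion₂_mono fun x _ y hy => lt_of_lt_of_le hy h)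
    (measure_ne_top μ _)

/-! ### The metric on the two-sided full shift on two symbols -/

open Classical in
/-- `d(x, y) = 2 ^ (-k)`, where `k` is the least `k ≥ 0` with `x k ≠ y k` or `x (-k) ≠ y (-k)`;
`d(x, x) = 0`. -/
def shiftDist (x y : ℤ → Bool) : ℝ :=
  if x = y then 0 else (1 / 2 : ℝ) ^ sInf {k : ℕ | x k ≠ y k ∨ x (-k) ≠ y (-k)}

theorem shiftDist_lt_iff (x y : ℤ → Bool) (m : ℕ) :
    shiftDist x y < (1 / 2 : ℝ) ^ m ↔ ∀ k : ℕ, k ≤ m → x k = y k ∧ x (-k) = y (-k) := by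
  unfold shiftDist
  split_ifs with h
  · subst h; simp
  · have hne : {k : ℕ | x k ≠ y k ∨ x (-k) ≠ y (-k)}.Nonempty := by
      obtain ⟨i, hi⟩ := Function.ne_iff.1 h
      obtain ⟨k, rfl | rfl⟩ := i.eq_nat_or_neg
      · exact ⟨k, Or.inl hi⟩
      · exact ⟨k, Or.inr hi⟩
    rw [pow_lt_pow_iff_right_of_lt_one₀ (by norm_num) (by norm_num)]
    constructor
    · intro hm k hk
      have := Nat.notMem_of_lt_sInf (lt_of_le_of_lt hk hm)
      simpa [not_or] using this
    · intro hm
      by_contra hlt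
      have := Nat.sInf_mem hne
      have h2 := hm _ (not_lt.1 hlt)
      rcases this with h3 | h3
      · exact h3 h2.1
      · exact h3 h2.2

theorem shiftDist_nonneg (x y : ℤ → Bool) : 0 ≤ shiftDist x y := by
  unfold shiftDist
  split_ifs <;> positivity

theorem shiftDist_self (x : ℤ → Bool) : shiftDist x x = 0 := by simp [shiftDist]

theorem shiftDist_comm (x y : ℤ → Bool) : shiftDist x y = shiftDist y x := by
  by_cases h : x = y
  · rw [h]
  · rw [shiftDist, shiftDist, if_neg h, if_neg (Ne.symm h)]
    simp only [ne_comm]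

theorem eq_of_shiftDist_eq_zero {x y : ℤ → Bool} (h : shiftDist x y = 0) : x = y := by
  by_contra hne
  have : 0 < shiftDist x y := by
    rw [shiftDist, if_neg hne]
    positivity
  exact this.ne' h

theorem shiftDist_le_max (x y z : ℤ → Bool) :
    shiftDist x z ≤ max (shiftDist x y) (shiftDist y z) := by
  by_contra hlt
  rw [not_le, max_lt_iff] at hlt
  have hne : x ≠ z := by
    rintro rfl
    exact absurd hlt.1 (not_lt.2 (by rw [shiftDist_self]; exact shiftDist_nonneg _ _))
  obtain ⟨m, hm⟩ : ∃ m : ℕ, shiftDist x z = (1 / 2 : ℝ) ^ m := ⟨_, by rw [shiftDist, if_neg hne]⟩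
  rw [hm, shiftDist_lt_iff, shiftDist_lt_iff] at hlt
  refine lt_irrefl (shiftDist x z) ?_
  conv_rhs => rw [hm]
  rw [shiftDist_lt_iff]
  exact fun k hk => ⟨(hlt.1 k hk).1.trans (hlt.2 k hk).1, (hlt.1 k hk).2.trans (hlt.2 k hk).2⟩

/-- The metric `shiftDist` on `{0,1}^ℤ`; it induces the product uniformity and topology. -/
instance fullShiftMetricSpace : MetricSpace (ℤ → Bool) where
  dist := shiftDist
  dist_self := shiftDist_self
  dist_comm := shiftDist_comm
  dist_triangle x y z := (shiftDist_le_max x y z).trans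
    (max_le_add_of_nonneg (shiftDist_nonneg _ _) (shiftDist_nonneg _ _))
  eq_of_dist_eq_zero := eq_of_shiftDist_eq_zero
  toUniformSpace := Pi.uniformSpace _
  uniformity_dist := by
    simp only [Pi.uniformity, DiscreteUniformity.eq_principal_setRelId, SetRel.id,
      comap_principal]
    apply le_antisymm
    · simp only [le_iInf_iff, le_principal_iff]
      intro ε εpos
      obtain ⟨m, hm⟩ : ∃ m : ℕ, (1 / 2 : ℝ) ^ m < ε := exists_pow_lt_of_lt_one εpos (by norm_num)
      apply mem_iInf_of_iInter (Set.finite_Icc (-(m : ℤ)) m)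
        (V := fun i => {p : (ℤ → Bool) × (ℤ → Bool) | p.1 i = p.2 i})
      · rintro ⟨i, hi⟩
        exact mem_principal.2 fun p hp => hp
      · rintro ⟨x, y⟩ hxy
        refine lt_trans ((shiftDist_lt_iff x y m).2 fun k hk => ?_) hm
        simp only [mem_iInter] at hxy
        exact ⟨hxy ⟨k, by simp; omega⟩, hxy ⟨-k, by simp; omega⟩⟩
    · simp only [le_iInf_iff, le_principal_iff]
      intro i
      refine mem_iInf_of_mem ((1 / 2 : ℝ) ^ i.natAbs) ?_
      refine mem_iInf_of_mem (by positivity) ?_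
      rw [mem_principal]
      rintro ⟨x, y⟩ hxy
      have h := (shiftDist_lt_iff x y i.natAbs).1 hxy i.natAbs le_rfl
      obtain hi | hi := i.natAbs_eq
      · rw [← hi] at h; exact h.1
      · rw [← hi] at h; exact h.2

/-! ### Sturmian systems -/

/-- The number of words of length `n` that appear in `u`. -/
def complexity (u : ℤ → Bool) (n : ℕ) : ℕ :=
  (Set.range fun (i : ℤ) (j : Fin n) => u (i + (j : ℕ))).ncard

/-- A bi-infinite sequence is eventually periodic if there is `p > 0` such that
`u (i + p) = u i` for all `i` outside a bounded interval (in both directions). -/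
def IsEventuallyPeriodic (u : ℤ → Bool) : Prop :=
  ∃ p : ℤ, 0 < p ∧ ∃ N : ℤ, ∀ i : ℤ, N ≤ |i| → u (i + p) = u i

/-- Bi-infinite Sturmian sequences. -/
def IsSturmian (u : ℤ → Bool) : Prop :=
  (∀ n : ℕ, 1 ≤ n → complexity u n = n + 1) ∧ ¬ IsEventuallyPeriodic u

/-- The shift map on `{0,1}^ℤ`. -/
def shift (x : ℤ → Bool) : ℤ → Bool := fun i => x (i + 1)

/-- `X_u`, the closure of the two-sided shift orbit of `u`. -/
def orbitClosure (u : ℤ → Bool) : Set (ℤ → Bool) :=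
  closure (Set.range fun (k : ℤ) (i : ℤ) => u (i + k))

theorem mapsTo_shift (u : ℤ → Bool) : MapsTo shift (orbitClosure u) (orbitClosure u) := by
  refine MapsTo.closure ?_ (continuous_pi fun i => continuous_apply (i + 1))
  rintro _ ⟨k, rfl⟩
  exact ⟨k + 1, funext fun i => by simp only [shift]; congr 1; ring⟩

/-- The shift map on `X_u`. -/
def subshift (u : ℤ → Bool) : orbitClosure u → orbitClosure u :=
  (mapsTo_shift u).restrict

end SlowEntropy

end

/-!
The proof identifies a Sturmian system with an irrational rotation of the circle.

*Balance.* A shortest pair of windows that violates balance has the form `a w a`, `b w b` with a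
palindrome `w` (`exists_palindromes_of_not_isBalanced`). Complexity `n + 1` allows one right special
factor of each length, so `a w`, say, is not right special. The palindrome property keeps `b w` out
of a window of length `2 |w| + 2`, where some factor must therefore recur, and the right half of `u`
is eventually periodic (`isRightPeriodic_of_palindromes`). A reflection takes care of the case that only the
left half is aperiodic. A balanced sequence has a slope `α`: windows of length `n` contain `n α`
letters `1` up to an error of at most `1`. The slope is irrational, as `u` is not eventually
periodic.

*Rotation.* All `x` in the orbit closure have the slope `α`. The partial sums of `x` are
`⌊n α + ρ⌋`, where `ρ` is the phase of `x`, unless some `n α + ρ` is an integer; so almost every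
`x` is the coding of its phase, and conversely every coding lies in the orbit closure
(`HasSlope.rotationCoding_phase`, `HasSlope.rotationCoding_mem`). As the irrational rotation is
uniquely ergodic, so is the subshift, and its invariant measure is the distribution of the coding of
a uniformly distributed point (`eq_map_codingMap`).

*Entropies.* The topological entropy is at most `1` because `(ε, n)`-Bowen balls are given by
factors of length `n + O(1)`, of which there are `n + O(1)`. If `p / q` approximates `α` with error
less than `1 / q ^ 2`, the cylinders of length `q` have measure at most `3 / q`, so at least `q / 6`
Bowen balls are needed for half of the measure; this happens for arbitrarily large `q`, and the
semi-topological entropy is at least `1`. Finally, a measurable partition of the circle changes little under a small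
translation, so typical points that are close to each other have orbits at small Hamming distance;
the number of Hamming balls needed is bounded independently of `n` (`exists_hammingBall_cover`), and
the metric entropy vanishes.
-/

namespace SlowEntropy

/-! ### Factors and right special factors -/

/-- The factor (word) of length `n` of `u` at position `i`. -/
def factor (u : ℤ → Bool) (n : ℕ) (i : ℤ) : Fin n → Bool := fun j => u (i + (j : ℕ))

theorem factor_eq_iff {u v : ℤ → Bool} {n : ℕ} {i j : ℤ} :
    factor u n i = factor v n j ↔ ∀ k : ℕ, k < n → u (i + k) = v (j + k) :=
  ⟨fun h k hk => congrFun h ⟨k, hk⟩, fun h => funext fun k => h k k.2⟩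

/-- The factor of length `n` at position `i` is right special: it is followed by both letters. -/
def IsRightSpecial (u : ℤ → Bool) (n : ℕ) (i : ℤ) : Prop :=
  ∃ j, factor u n j = factor u n i ∧ u (j + n) ≠ u (i + n)

/-- Eventual periodicity of the right half of `u`. -/
def IsRightPeriodic (u : ℤ → Bool) : Prop :=
  ∃ p : ℤ, 0 < p ∧ ∃ N : ℤ, ∀ i : ℤ, N ≤ i → u (i + p) = u i

theorem IsRightSpecial.congr {u : ℤ → Bool} {n : ℕ} {i j : ℤ} (h : IsRightSpecial u n i)
    (hij : factor u n i = factor u n j) : IsRightSpecial u n j := by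
  obtain ⟨k, hk, hne⟩ := h
  by_cases hj : u (i + n) = u (j + n)
  · exact ⟨k, hk.trans hij, hj ▸ hne⟩
  · exact ⟨i, hij, hj⟩

theorem factor_succ_eq_iff {u v : ℤ → Bool} {n : ℕ} {i j : ℤ} :
    factor u (n + 1) i = factor v (n + 1) j ↔
      factor u n i = factor v n j ∧ u (i + n) = v (j + n) := by
  simp only [factor_eq_iff]
  constructor
  · exact fun h => ⟨fun k hk => h k (by omega), h n (by omega)⟩
  · rintro ⟨h1, h2⟩ k hk
    obtain hk | rfl : k < n ∨ k = n := by omega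
    · exact h1 k hk
    · exact h2

theorem factor_succ_eq_iff' {u v : ℤ → Bool} {n : ℕ} {i j : ℤ} :
    factor u (n + 1) i = factor v (n + 1) j ↔
      u i = v j ∧ factor u n (i + 1) = factor v n (j + 1) := by
  simp only [factor_eq_iff]
  have e : ∀ (z : ℤ) (k : ℕ), z + ((k + 1 : ℕ) : ℤ) = z + 1 + k := by intro z k; push_cast; ring
  constructor
  · intro h
    refine ⟨by simpa using h 0 (by omega), fun k hk => ?_⟩
    rw [← e, ← e]
    exact h (k + 1) (by omega)
  · rintro ⟨h1, h2⟩ (_ | k) hk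
    · simpa using h1
    · rw [e, e]
      exact h2 k (by omega)

theorem IsRightSpecial.tail {u : ℤ → Bool} {n : ℕ} {i : ℤ} (h : IsRightSpecial u (n + 1) i) :
    IsRightSpecial u n (i + 1) := by
  obtain ⟨j, hj, hne⟩ := h
  refine ⟨j + 1, (factor_succ_eq_iff'.1 hj).2, ?_⟩
  push_cast at hne
  rwa [add_assoc, add_assoc, add_comm 1 (n : ℤ)]

theorem complexity_zero (u : ℤ → Bool) : complexity u 0 = 1 := by
  have : (range fun (i : ℤ) (j : Fin 0) => u (i + (j : ℕ))) = {Fin.elim0} := by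
    ext w
    simp only [mem_range, mem_singleton_iff]
    exact ⟨fun _ => Subsingleton.elim _ _, fun _ => ⟨0, Subsingleton.elim _ _⟩⟩
  rw [complexity, this, ncard_singleton]

/-- If the complexity grows by at most one from `n` to `n + 1`, there is at most one right special
factor of length `n`. -/
theorem IsRightSpecial.factor_eq {u : ℤ → Bool} {n : ℕ}
    (hc : complexity u (n + 1) ≤ complexity u n + 1) {i j : ℤ} (hi : IsRightSpecial u n i)
    (hj : IsRightSpecial u n j) : factor u n i = factor u n j := by
  by_contra hne
  obtain ⟨i', hi1, hi2⟩ := hi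
  obtain ⟨j', hj1, hj2⟩ := hj
  set W := range (factor u (n + 1)) with hW
  have hfin : W.Finite := Set.toFinite _
  -- Removing one extension of each of the two factors still leaves all factors of length `n`.
  have hsub : range (factor u n) ⊆ Fin.init '' (W \ {factor u (n + 1) i, factor u (n + 1) j}) := by
    have key : ∀ k, factor u (n + 1) k ≠ factor u (n + 1) i →
        factor u (n + 1) k ≠ factor u (n + 1) j →
        factor u n k ∈ Fin.init '' (W \ {factor u (n + 1) i, factor u (n + 1) j}) :=
      fun k h1 h2 => ⟨factor u (n + 1) k, ⟨⟨k, rfl⟩, by simp [h1, h2]⟩, rfl⟩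
    rintro _ ⟨k, rfl⟩
    by_cases h1 : factor u (n + 1) k = factor u (n + 1) i
    · rw [(factor_succ_eq_iff.1 h1).1, ← hi1]
      refine key i' (fun h => hi2 (factor_succ_eq_iff.1 h).2) fun h => hne ?_
      rw [← hi1]
      exact (factor_succ_eq_iff.1 h).1
    by_cases h2 : factor u (n + 1) k = factor u (n + 1) j
    · rw [(factor_succ_eq_iff.1 h2).1, ← hj1]
      refine key j' (fun h => hne ?_) (fun h => hj2 (factor_succ_eq_iff.1 h).2)
      rw [← hj1]
      exact (factor_succ_eq_iff.1 h).1.symm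
    exact key k h1 h2
  have hab : factor u (n + 1) i ≠ factor u (n + 1) j := fun h => hne (factor_succ_eq_iff.1 h).1
  have hpair : {factor u (n + 1) i, factor u (n + 1) j} ⊆ W := by
    rintro _ (rfl | rfl) <;> exact ⟨_, rfl⟩
  have h1 : complexity u n ≤ (W \ {factor u (n + 1) i, factor u (n + 1) j}).ncard :=
    (ncard_le_ncard hsub (Set.toFinite _)).trans (ncard_image_le hfin.sdiff)
  have h2 := ncard_sdiff_add_ncard_of_subset hpair hfin
  rw [ncard_pair hab] at h2
  have h3 : complexity u (n + 1) = W.ncard := rfl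
  omega

/-- A factor that recurs without a right special factor in between forces periodicity. -/
theorem isRightPeriodic_of_factor_eq {u : ℤ → Bool} {n : ℕ} {a b : ℤ} (hab : a < b)
    (h : factor u n a = factor u n b) (hns : ∀ k, a ≤ k → k < b → ¬ IsRightSpecial u n k) :
    IsRightPeriodic u := by
  have step : ∀ t : ℕ, factor u n (a + t) = factor u n (b + t) →
      ¬ IsRightSpecial u n (a + t) → u (b + t + n) = u (a + t + n) := by
    intro t h1 h2
    by_contra hne
    exact h2 ⟨b + t, h1.symm, hne⟩
  have key : ∀ t : ℕ, factor u n (a + t) = factor u n (b + t) ∧ ¬ IsRightSpecial u n (a + t) := by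
    intro t
    induction t using Nat.strong_induction_on with
    | _ t ih =>
      constructor
      · rcases t with _ | t
        · simpa using h
        · obtain ⟨h1, h2⟩ := ih t (by omega)
          have h3 := step t h1 h2
          have h4 := factor_succ_eq_iff.2 ⟨h1, h3.symm⟩
          rw [factor_eq_iff] at h4 ⊢
          intro k hk
          have := h4 (k + 1) (by omega)
          push_cast at this ⊢
          convert this using 2 <;> ring
      · rcases lt_or_ge (a + t) b with hlt | hge
        · exact hns _ (by omega) hlt
        · obtain ⟨s, hs⟩ : ∃ s : ℕ, a + t = b + s := ⟨(a + t - b).toNat, by omega⟩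
          obtain ⟨h1, h2⟩ := ih s (by omega)
          rw [hs]
          exact fun h3 => h2 (h3.congr h1.symm)
  refine ⟨b - a, by omega, a + n, fun i hi => ?_⟩
  obtain ⟨t, rfl⟩ : ∃ t : ℕ, i = a + t + n := ⟨(i - a - n).toNat, by omega⟩
  rw [← step t (key t).1 (key t).2]
  congr 1; ring

/-! ### Partial sums and balance -/

/-- The partial sums of the letters of `x`, from position `0`; negative to the left of `0`, so that
`psum x (i + n) - psum x i` counts the letters `1` in the window `[i, i + n)`. -/
noncomputable def psum (x : ℤ → Bool) (n : ℤ) : ℤ :=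
  ∑ k ∈ Finset.Ico 0 n, (x k).toInt - ∑ k ∈ Finset.Ico n 0, (x k).toInt

@[simp]
theorem psum_zero (x : ℤ → Bool) : psum x 0 = 0 := by simp [psum]

theorem psum_add_one (x : ℤ → Bool) (n : ℤ) : psum x (n + 1) = psum x n + (x n).toInt := by
  rcases le_or_gt 0 n with h | h
  · have h1 : Finset.Ico 0 (n + 1) = insert n (Finset.Ico 0 n) := by ext; simp; omega
    rw [psum, psum, h1, Finset.sum_insert (by simp), Finset.Ico_eq_empty (a := n) (by omega),
      Finset.Ico_eq_empty (a := n + 1) (by omega)]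
    simp [add_comm]
  · have h1 : Finset.Ico n 0 = insert n (Finset.Ico (n + 1) 0) := by ext; simp; omega
    rw [psum, psum, h1, Finset.sum_insert (by simp), Finset.Ico_eq_empty (b := n) (by omega),
      Finset.Ico_eq_empty (b := n + 1) (by omega)]
    simp

theorem toInt_eq_zero_or_one (b : Bool) : b.toInt = 0 ∨ b.toInt = 1 := by cases b <;> simp

theorem toInt_injective : Function.Injective Bool.toInt := by
  intro a b h; cases a <;> cases b <;> simp_all

/-- Windows with the same letters contain the same number of letters `1`. -/
theorem psum_sub_congr {x y : ℤ → Bool} {i j : ℤ} {n : ℕ}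
    (h : ∀ k : ℕ, k < n → x (i + k) = y (j + k)) :
    psum x (i + n) - psum x i = psum y (j + n) - psum y j := by
  induction n with
  | zero => simp
  | succ n ih =>
    have h1 := ih fun k hk => h k (by omega)
    have h2 := h n (by omega)
    push_cast
    rw [← add_assoc, ← add_assoc, psum_add_one, psum_add_one, h2]
    linarith

/-- Any two windows of the same length have numbers of letters `1` that differ by at most one. -/
def IsBalanced (u : ℤ → Bool) : Prop :=
  ∀ (n : ℕ) (i j : ℤ), psum u (i + n) - psum u i ≤ psum u (j + n) - psum u j + 1

/-- A shortest pair of windows violating balance consists of two palindromes `a w a` and `b w b`,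
with `a ≠ b` and the same `w`. -/
theorem exists_palindromes_of_not_isBalanced {u : ℤ → Bool} (h : ¬ IsBalanced u) :
    ∃ (m : ℕ) (i j : ℤ), u i ≠ u j ∧ (∀ k : ℕ, k < m → u (i + 1 + k) = u (j + 1 + k)) ∧
      (∀ k : ℕ, k ≤ m + 1 → u (i + k) = u (i + (m + 1) - k)) ∧
      (∀ k : ℕ, k ≤ m + 1 → u (j + k) = u (j + (m + 1) - k)) := by
  classical
  have hex : ∃ n : ℕ, ∃ i j : ℤ, psum u (j + n) - psum u j + 1 < psum u (i + n) - psum u i := by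
    simpa only [IsBalanced, not_forall, not_le] using h
  obtain ⟨i, j, hij⟩ := Nat.find_spec hex
  set n := Nat.find hex with hn
  have hmin : ∀ k < n, ∀ i j : ℤ, psum u (i + k) - psum u i ≤ psum u (j + k) - psum u j + 1 := by
    intro k hk i j
    have := Nat.find_min hex hk
    push Not at this
    exact this i j
  clear_value n
  have hn2 : 2 ≤ n := by
    by_contra hlt
    obtain rfl | rfl : n = 0 ∨ n = 1 := by omega
    · simp at hij
    · simp only [Nat.cast_one, psum_add_one] at hij
      have := toInt_eq_zero_or_one (u i)
      have := toInt_eq_zero_or_one (u j)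
      omega
  obtain ⟨m, rfl⟩ : ∃ m, n = m + 2 := ⟨n - 2, by omega⟩
  -- By minimality the excess of the first window over the second one is `1` at every interior
  -- point and `2` at the end.
  have hd : ∀ k : ℕ, 0 < k → k < m + 2 →
      psum u (i + k) - psum u i = psum u (j + k) - psum u j + 1 := by
    intro k hk0 hk
    have h1 := hmin k hk i j
    have h2 := hmin (m + 2 - k) (by omega) (i + k) (j + k)
    have e1 : i + (k : ℤ) + ((m + 2 - k : ℕ) : ℤ) = i + ((m + 2 : ℕ) : ℤ) := by omega
    have e2 : j + (k : ℤ) + ((m + 2 - k : ℕ) : ℤ) = j + ((m + 2 : ℕ) : ℤ) := by omega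
    rw [e1, e2] at h2
    omega
  have hend : psum u (i + (m + 2 : ℕ)) - psum u i = psum u (j + (m + 2 : ℕ)) - psum u j + 2 := by
    have h1 := hd (m + 1) (by omega) (by omega)
    have e : ∀ z : ℤ, z + ((m + 2 : ℕ) : ℤ) = z + ((m + 1 : ℕ) : ℤ) + 1 := by
      intro z; push_cast; ring
    rw [e, e, psum_add_one, psum_add_one] at hij ⊢
    have := toInt_eq_zero_or_one (u (i + (m + 1 : ℕ)))
    have := toInt_eq_zero_or_one (u (j + (m + 1 : ℕ)))
    omega
  have hfirst : (u i).toInt = 1 ∧ (u j).toInt = 0 := by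
    have h1 := hd 1 (by omega) (by omega)
    simp only [Nat.cast_one, psum_add_one] at h1
    have := toInt_eq_zero_or_one (u i)
    have := toInt_eq_zero_or_one (u j)
    omega
  have hlast : (u (i + (m + 1))).toInt = 1 ∧ (u (j + (m + 1))).toInt = 0 := by
    have h1 := hd (m + 1) (by omega) (by omega)
    have e : ∀ z : ℤ, z + ((m + 2 : ℕ) : ℤ) = z + (m + 1) + 1 := by intro z; push_cast; ring
    rw [e, e, psum_add_one, psum_add_one] at hend
    push_cast at h1
    have := toInt_eq_zero_or_one (u (i + (m + 1)))
    have := toInt_eq_zero_or_one (u (j + (m + 1)))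
    omega
  have hmid : ∀ k : ℕ, k < m → u (i + 1 + k) = u (j + 1 + k) := by
    intro k hk
    apply toInt_injective
    have h1 := hd (k + 1) (by omega) (by omega)
    have h2 := hd (k + 1 + 1) (by omega) (by omega)
    have e : ∀ z : ℤ, z + ((k + 1 + 1 : ℕ) : ℤ) = z + 1 + k + 1 := by intro z; push_cast; ring
    have e' : ∀ z : ℤ, z + ((k + 1 : ℕ) : ℤ) = z + 1 + k := by intro z; push_cast; ring
    rw [e, e, psum_add_one, psum_add_one] at h2
    rw [e', e'] at h1
    omega
  -- Comparing the prefixes of either window with the suffixes of the other one shows that the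
  -- prefix and the suffix of length `k` contain equally many letters `1`.
  have hpal : ∀ k : ℕ, k ≤ m + 2 →
      psum u (j + k) - psum u j = psum u (j + (m + 2 : ℕ)) - psum u (j + (m + 2 : ℕ) - k) := by
    intro k hk
    rcases Nat.eq_zero_or_pos k with rfl | hk0
    · simp
    obtain rfl | hk : k = m + 2 ∨ k < m + 2 := by omega
    · simp
    have h1 := hd k hk0 hk
    have h2 := hd (m + 2 - k) (by omega) (by omega)
    have h3 := hmin k hk i (j + (m + 2 : ℕ) - k)
    have h4 := hmin k hk (i + (m + 2 : ℕ) - k) j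
    have e : ∀ z : ℤ, z + ((m + 2 - k : ℕ) : ℤ) = z + ((m + 2 : ℕ) : ℤ) - k := by intro z; omega
    rw [e, e] at h2
    rw [sub_add_cancel] at h3 h4
    omega
  have hpalj : ∀ k : ℕ, k ≤ m + 1 → u (j + k) = u (j + (m + 1) - k) := by
    intro k hk
    apply toInt_injective
    have h1 := hpal k (by omega)
    have h2 := hpal (k + 1) (by omega)
    have e : j + ((m + 2 : ℕ) : ℤ) - k = j + (m + 1) - k + 1 := by push_cast; ring
    have e' : j + ((m + 2 : ℕ) : ℤ) - ((k + 1 : ℕ) : ℤ) = j + (m + 1) - k := by push_cast; ring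
    have e2 : j + ((k + 1 : ℕ) : ℤ) = j + k + 1 := by push_cast; ring
    rw [e, psum_add_one] at h1
    rw [e', e2, psum_add_one] at h2
    omega
  refine ⟨m, i, j, fun h => by rw [h] at hfirst; omega, hmid, fun k hk => ?_, hpalj⟩
  rcases Nat.eq_zero_or_pos k with rfl | hk0
  · apply toInt_injective
    simp only [Nat.cast_zero, add_zero, sub_zero]
    omega
  obtain rfl | hk : k = m + 1 ∨ k < m + 1 := by omega
  · apply toInt_injective
    have e : i + (m + 1) - ((m + 1 : ℕ) : ℤ) = i := by push_cast; ring
    rw [e]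
    push_cast
    omega
  have h1 := hmid (k - 1) (by omega)
  have h2 := hmid (m - k) (by omega)
  have e : ∀ z : ℤ, z + 1 + ((k - 1 : ℕ) : ℤ) = z + k := by intro z; omega
  have e' : ∀ z : ℤ, z + 1 + ((m - k : ℕ) : ℤ) = z + (m + 1) - k := by intro z; omega
  rw [e, e] at h1
  rw [e', e'] at h2
  rw [h1, h2, hpalj k hk.le]

/-- Let `a w a` occur at `i` and `b w b` at `j`, with `a ≠ b` and `w` a palindrome. If `a w` is not
right special, then `b w`, the only candidate for a right special factor, does not occur in the
window of length `2 |w| + 2` starting at `i`; some other factor of that length occurs twice there. -/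
theorem isRightPeriodic_of_palindromes {u : ℤ → Bool} (hc : ∀ n, 1 ≤ n → complexity u n = n + 1)
    {m : ℕ} {i j : ℤ} (hne : u i ≠ u j) (hmid : ∀ k : ℕ, k < m → u (i + 1 + k) = u (j + 1 + k))
    (hpal : ∀ k : ℕ, k ≤ m + 1 → u (i + k) = u (i + (m + 1) - k))
    (hj : u j = u (j + (m + 1))) (hi : ¬ IsRightSpecial u (m + 1) i) : IsRightPeriodic u := by
  have hnot : ∀ k : ℕ, k ≤ m + 1 → factor u (m + 1) (i + k) ≠ factor u (m + 1) j := by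
    intro k hk heq
    rw [factor_eq_iff] at heq
    have h0 := heq 0 (by omega)
    simp only [Nat.cast_zero, add_zero] at h0
    rcases Nat.eq_zero_or_pos k with rfl | hk0
    · simp only [Nat.cast_zero, add_zero] at h0
      exact hne h0
    have hend := hpal (m + 1) le_rfl
    push_cast at hend
    rw [add_sub_cancel_right] at hend
    -- The letter at `i + k` is `b`; by the palindrome property so is the letter at
    -- `i + (m + 1) - k`, and the occurrence of `b w` at `i + k` moves it to the last letter `a`.
    have h1 := hpal k hk
    apply hne
    obtain rfl | hk : k = m + 1 ∨ k < m + 1 := by omega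
    · push_cast at h0
      rw [← h0, hend]
    · have h2 := heq (m + 1 - k) (by omega)
      have h3 := hmid (m - k) (by omega)
      have e1 : i + (k : ℤ) + ((m + 1 - k : ℕ) : ℤ) = i + (m + 1) := by omega
      have e2 : j + ((m + 1 - k : ℕ) : ℤ) = j + 1 + ((m - k : ℕ) : ℤ) := by omega
      have e3 : i + 1 + ((m - k : ℕ) : ℤ) = i + (m + 1) - k := by omega
      rw [e1, e2, ← h3, e3, ← h1, h0, hend] at h2
      exact h2
  have hend : u (i + (m + 1)) = u i := by simpa using (hpal 0 (by omega)).symm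
  have hw : IsRightSpecial u m (i + 1) := by
    refine ⟨j + 1, factor_eq_iff.2 fun k hk => (hmid k hk).symm, ?_⟩
    rw [add_assoc, add_assoc, add_comm 1 (m : ℤ), hend, ← hj]
    exact hne.symm
  -- A right special factor of length `m + 1` ends in `w`, so it is `a w` or `b w`.
  have hns : ∀ k : ℕ, k ≤ m + 1 → ¬ IsRightSpecial u (m + 1) (i + k) := by
    intro k hk hs
    have hwk : factor u m (i + k + 1) = factor u m (i + 1) := hs.tail.factor_eq (by
      rcases Nat.eq_zero_or_pos m with rfl | hm
      · rw [hc _ le_rfl, complexity_zero]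
      · rw [hc _ (by omega), hc _ (by omega)]) hw
    have hcons : ∀ l, u (i + k) = u l → factor u m (i + 1) = factor u m (l + 1) →
        factor u (m + 1) (i + k) = factor u (m + 1) l :=
      fun l h1 h2 => factor_succ_eq_iff'.2 ⟨h1, hwk.trans h2⟩
    by_cases hik : u (i + k) = u i
    · exact hi (hs.congr (hcons i hik rfl))
    · refine hnot k hk (hcons j ?_ (factor_eq_iff.2 hmid))
      revert hik hne
      cases u (i + k) <;> cases u i <;> cases u j <;> simp
  -- There are `m + 2` positions and only `m + 1` factors other than `b w`.
  have hcard : (range (factor u (m + 1)) \ {factor u (m + 1) j}).ncard <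
      (Set.Iio (m + 2)).ncard := by
    rw [ncard_sdiff_singleton_of_mem (mem_range_self j), ← Finset.coe_Iio, ncard_coe_finset,
      Nat.card_Iio]
    have : (range (factor u (m + 1))).ncard = m + 1 + 1 := hc (m + 1) (by omega)
    omega
  obtain ⟨a, ha, b, hb, hab, heq⟩ := Set.exists_ne_map_eq_of_ncard_lt_of_maps_to hcard
    (f := fun k : ℕ => factor u (m + 1) (i + k))
    fun k hk => ⟨⟨_, rfl⟩, hnot k (by have := mem_Iio.1 hk; omega)⟩
  rw [mem_Iio] at ha hb
  wlog hlt : a < b generalizing a b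
  · exact this b hb a ha hab.symm heq.symm (by omega)
  refine isRightPeriodic_of_factor_eq (a := i + a) (b := i + b) (by omega) heq fun k h1 h2 => ?_
  have := hns (k - i).toNat (by omega)
  rwa [show i + ((k - i).toNat : ℤ) = k by omega] at this

/-- The language of `u` is balanced if `u` has the complexity of a Sturmian sequence and its right
half is aperiodic. -/
theorem isBalanced_of_not_isRightPeriodic {u : ℤ → Bool}
    (hc : ∀ n, 1 ≤ n → complexity u n = n + 1) (hp : ¬ IsRightPeriodic u) : IsBalanced u := by
  by_contra hb
  obtain ⟨m, i, j, hne, hmid, hi, hj⟩ := exists_palindromes_of_not_isBalanced hb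
  have hfne : factor u (m + 1) i ≠ factor u (m + 1) j := by
    intro h
    have := factor_eq_iff.1 h 0 (by omega)
    simp only [Nat.cast_zero, add_zero] at this
    exact hne this
  have hend : ∀ z : ℤ, (∀ k : ℕ, k ≤ m + 1 → u (z + k) = u (z + (m + 1) - k)) →
      u z = u (z + (m + 1)) := fun z h => by simpa using h 0 (by omega)
  by_cases h1 : IsRightSpecial u (m + 1) i
  · refine hp (isRightPeriodic_of_palindromes hc hne.symm (fun k hk => (hmid k hk).symm) hj
      (hend i hi) fun h2 => hfne (h1.factor_eq (by rw [hc _ (by omega), hc _ (by omega)]) h2))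
  · exact hp (isRightPeriodic_of_palindromes hc hne hmid hi (hend j hj) h1)

/-! ### Reflection -/

theorem psum_reflect (u : ℤ → Bool) (n : ℤ) :
    psum (fun i => u (-i)) n = - psum u (1 - n) + psum u 1 := by
  have key : ∀ z : ℤ, psum (fun i => u (-i)) (z + 1) + psum u (1 - (z + 1)) =
      psum (fun i => u (-i)) z + psum u (1 - z) := by
    intro z
    have h := psum_add_one u (-z)
    rw [psum_add_one, show 1 - (z + 1) = -z by ring, show 1 - z = -z + 1 by ring, h]
    ring
  have : ∀ z : ℤ, psum (fun i => u (-i)) z + psum u (1 - z) = psum u 1 := by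
    intro z
    induction z using Int.induction_on with
    | zero => simp
    | succ z ih => rw [key, ih]
    | pred z ih => rw [← key, sub_add_cancel, ih]
  linarith [this n]

theorem IsBalanced.of_reflect {u : ℤ → Bool} (h : IsBalanced fun i => u (-i)) : IsBalanced u := by
  intro n i j
  have := h n (1 - i - n) (1 - j - n)
  simp only [psum_reflect] at this
  ring_nf at this ⊢
  linarith

theorem complexity_reflect (u : ℤ → Bool) (n : ℕ) :
    complexity (fun i => u (-i)) n = complexity u n := by
  have : range (factor (fun i => u (-i)) n) = (fun w => w ∘ Fin.rev) '' range (factor u n) := by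
    ext w
    simp only [mem_range, mem_image, exists_exists_eq_and]
    have key : ∀ i, factor (fun i => u (-i)) n i = factor u n (1 - n - i) ∘ Fin.rev := by
      intro i
      funext k
      simp only [factor, Function.comp, Fin.val_rev]
      congr 1
      omega
    constructor
    · rintro ⟨i, rfl⟩
      exact ⟨_, (key i).symm⟩
    · rintro ⟨i, rfl⟩
      refine ⟨1 - n - i, ?_⟩
      rw [key]
      congr 2
      ring
  change (range (factor (fun i => u (-i)) n)).ncard = (range (factor u n)).ncard
  rw [this, ncard_image_of_injective]
  intro v w hvw
  funext k
  simpa using congrFun hvw k.rev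

/-- If both halves are eventually periodic, a common multiple of the two periods works on both
sides. -/
theorem isEventuallyPeriodic_of_isRightPeriodic {u : ℤ → Bool} (h1 : IsRightPeriodic u)
    (h2 : IsRightPeriodic fun i => u (-i)) : IsEventuallyPeriodic u := by
  obtain ⟨p, hp, N, hN⟩ := h1
  obtain ⟨q, hq, M, hM⟩ := h2
  have e1 : ∀ (t : ℕ) (i : ℤ), N ≤ i → u (i + t * p) = u i := by
    intro t
    induction t with
    | zero => simp
    | succ t ih =>
      intro i hi
      rw [← ih i hi, ← hN (i + t * p) (by nlinarith)]
      congr 1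
      push_cast
      ring
  have e2 : ∀ (t : ℕ) (i : ℤ), M ≤ i → u (-(i + t * q)) = u (-i) := by
    intro t
    induction t with
    | zero => simp
    | succ t ih =>
      intro i hi
      refine Eq.trans ?_ ((hM (i + t * q) (by nlinarith)).trans (ih i hi))
      simp only
      congr 1
      push_cast
      ring
  refine ⟨q * p, by positivity, |N| + |M| + q * p, fun i hi => ?_⟩
  have hpos : 0 < q * p := by positivity
  rcases le_total 0 i with h | h
  · rw [abs_of_nonneg h] at hi
    have := e1 q.toNat i (by have := le_abs_self N; have := abs_nonneg M; omega)
    rwa [Int.toNat_of_nonneg hq.le] at this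
  · rw [abs_of_nonpos h] at hi
    have := e2 p.toNat (-(i + q * p)) (by have := le_abs_self M; have := abs_nonneg N; omega)
    rw [Int.toNat_of_nonneg hp.le, neg_neg] at this
    rw [← this]
    congr 1
    ring

/-- Sturmian sequences are balanced. -/
theorem IsSturmian.isBalanced {u : ℤ → Bool} (hu : IsSturmian u) : IsBalanced u := by
  by_cases h1 : IsRightPeriodic u
  · have h2 : ¬ IsRightPeriodic fun i => u (-i) := fun h2 =>
      hu.2 (isEventuallyPeriodic_of_isRightPeriodic h1 h2)
    exact (isBalanced_of_not_isRightPeriodic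
      (fun n hn => (complexity_reflect u n).trans (hu.1 n hn)) h2).of_reflect
  · exact isBalanced_of_not_isRightPeriodic hu.1 h1

/-! ### The slope of a balanced sequence -/

/-- The number of letters `1` in any window of `x` differs by at most one from `α` times the length
of the window. -/
def HasSlope (x : ℤ → Bool) (α : ℝ) : Prop :=
  ∀ (i : ℤ) (n : ℕ), |(psum x (i + n) : ℝ) - psum x i - n * α| ≤ 1

theorem HasSlope.abs_sub_le {x : ℤ → Bool} {α : ℝ} (h : HasSlope x α) (m n : ℤ) :
    |((psum x m : ℝ) - m * α) - (psum x n - n * α)| ≤ 1 := by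
  wlog hnm : n ≤ m generalizing m n
  · rw [abs_sub_comm]
    exact this n m (by omega)
  have := h n (m - n).toNat
  have e : (((m - n).toNat : ℕ) : ℤ) = m - n := Int.toNat_of_nonneg (by omega)
  have e' : (((m - n).toNat : ℕ) : ℝ) = m - n := by exact_mod_cast congrArg (Int.cast (R := ℝ)) e
  rw [e, e', add_sub_cancel] at this
  convert this using 2
  ring

theorem IsBalanced.mul_le_psum {u : ℤ → Bool} (hu : IsBalanced u) (n : ℕ) (i j : ℤ) (k : ℕ) :
    k * (psum u (i + n) - psum u i - 1) ≤ psum u (j + k * n) - psum u j := by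
  induction k with
  | zero => simp
  | succ k ih =>
    have h1 := hu n i (j + k * n)
    have e : j + ((k + 1 : ℕ) : ℤ) * n = j + k * n + n := by push_cast; ring
    rw [e]
    push_cast
    linarith

theorem IsBalanced.psum_le_mul {u : ℤ → Bool} (hu : IsBalanced u) (n : ℕ) (i j : ℤ) (k : ℕ) :
    psum u (j + k * n) - psum u j ≤ k * (psum u (i + n) - psum u i + 1) := by
  induction k with
  | zero => simp
  | succ k ih =>
    have h1 := hu n (j + k * n) i
    have e : j + ((k + 1 : ℕ) : ℤ) * n = j + k * n + n := by push_cast; ring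
    rw [e]
    push_cast
    linarith

theorem IsBalanced.exists_hasSlope {u : ℤ → Bool} (hu : IsBalanced u) : ∃ α, HasSlope u α := by
  have key : ∀ (n k : ℕ) (i j : ℤ), ((psum u (i + (n + 1 : ℕ)) : ℝ) - psum u i - 1) / (n + 1 : ℕ) ≤
      ((psum u (j + (k + 1 : ℕ)) : ℝ) - psum u j + 1) / (k + 1 : ℕ) := by
    intro n k i j
    -- Split a window of length `(n + 1) * (k + 1)` in two ways.
    have h1 := hu.mul_le_psum (n + 1) i 0 (k + 1)
    have h2 := hu.psum_le_mul (k + 1) j 0 (n + 1)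
    rw [mul_comm ((k + 1 : ℕ) : ℤ) ((n + 1 : ℕ) : ℤ)] at h1
    have h3 := h1.trans h2
    rw [div_le_div_iff₀ (by positivity) (by positivity)]
    have h4 : (((k + 1 : ℕ) * (psum u (i + (n + 1 : ℕ)) - psum u i - 1) : ℤ) : ℝ) ≤
      ((n + 1 : ℕ) * (psum u (j + (k + 1 : ℕ)) - psum u j + 1) : ℤ) := by exact_mod_cast h3
    push_cast at h4 ⊢
    linarith
  set a : ℤ × ℕ → ℝ := fun p =>
    ((psum u (p.1 + (p.2 + 1 : ℕ)) : ℝ) - psum u p.1 - 1) / (p.2 + 1 : ℕ)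
  have hbdd : BddAbove (range a) := ⟨_, by rintro _ ⟨p, rfl⟩; exact key p.2 0 p.1 0⟩
  refine ⟨⨆ p, a p, fun i n => ?_⟩
  rcases n with _ | n
  · simp
  have h1 : ((psum u (i + (n + 1 : ℕ)) : ℝ) - psum u i - 1) / (n + 1 : ℕ) ≤ ⨆ p, a p :=
    le_ciSup hbdd (i, n)
  have h2 : ⨆ p, a p ≤ ((psum u (i + (n + 1 : ℕ)) : ℝ) - psum u i + 1) / (n + 1 : ℕ) :=
    ciSup_le fun p => key p.2 n p.1 i
  rw [div_le_iff₀ (by positivity)] at h1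
  rw [le_div_iff₀ (by positivity)] at h2
  rw [abs_le]
  constructor <;> linarith

theorem exists_forall_eq_of_monotone_of_abs_le {g : ℤ → ℤ} (hg : Monotone g) {C : ℤ}
    (hC : ∀ i, |g i| ≤ C) : ∃ N : ℤ, ∀ i : ℤ, N ≤ |i| → g (i + 1) = g i := by
  obtain ⟨_, ⟨a, rfl⟩, ha⟩ := Int.exists_greatest_of_bdd (P := fun z => z ∈ range g)
    ⟨C, by rintro _ ⟨i, rfl⟩; exact (abs_le.1 (hC i)).2⟩ ⟨_, 0, rfl⟩
  obtain ⟨_, ⟨b, rfl⟩, hb⟩ := Int.exists_least_of_bdd (P := fun z => z ∈ range g)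
    ⟨-C, by rintro _ ⟨i, rfl⟩; exact (abs_le.1 (hC i)).1⟩ ⟨_, 0, rfl⟩
  refine ⟨|a| + |b| + 1, fun i hi => ?_⟩
  rcases le_total 0 i with h | h
  · rw [abs_of_nonneg h] at hi
    have hai : a ≤ i := by have := le_abs_self a; have := abs_nonneg b; omega
    have h1 := ha _ ⟨i + 1, rfl⟩
    have h2 := hg hai
    have h3 := hg (show i ≤ i + 1 by omega)
    omega
  · rw [abs_of_nonpos h] at hi
    have hib : i + 1 ≤ b := by have := neg_abs_le b; have := abs_nonneg a; omega
    have h1 := hb _ ⟨i, rfl⟩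
    have h2 := hg hib
    have h3 := hg (show i ≤ i + 1 by omega)
    omega

/-- A balanced sequence of rational slope `p / q` is eventually periodic: by balance the number of
letters `1` in a window of length `q` deviates from `p` in one direction only, and the deviations
have a bounded sum. -/
theorem IsBalanced.irrational {u : ℤ → Bool} (hb : IsBalanced u) {α : ℝ} (hα : HasSlope u α)
    (hu : ¬ IsEventuallyPeriodic u) : Irrational α := by
  rintro ⟨r, rfl⟩
  apply hu
  set q := r.den with hq
  have hq0 : 0 < q := r.pos
  have hr : (q : ℝ) * r = r.num := by
    have : (r : ℝ) = r.num / r.den := by exact_mod_cast (Rat.num_div_den r).symm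
    rw [this, ← hq]
    field_simp
  -- `g i` is the sum of the deviations `psum u (j + q) - psum u j - r.num` over `0 ≤ j < i`.
  set g : ℤ → ℤ := fun i => ∑ k ∈ Finset.range q, (psum u (i + k) - psum u k) - i * r.num with hg
  have hstep : ∀ i, g (i + 1) - g i = psum u (i + q) - psum u i - r.num := by
    intro i
    have h1 := Finset.sum_range_succ_sub_sum (fun k : ℕ => psum u (i + k)) (n := q)
    have h2 := Finset.sum_range_succ' (fun k : ℕ => psum u (i + k)) q
    have h3 : ∀ k : ℕ, i + 1 + (k : ℤ) = i + ((k + 1 : ℕ) : ℤ) := by intro k; push_cast; ring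
    simp only [hg, Finset.sum_sub_distrib, h3]
    simp only [Nat.cast_zero, add_zero] at h2
    linarith
  have hbound : ∀ i, |g i| ≤ q := by
    intro i
    have h1 : |((g i : ℤ) : ℝ)| ≤ q := by
      have e : ((g i : ℤ) : ℝ) = ∑ k ∈ Finset.range q,
          (((psum u (i + k) : ℝ) - (i + k : ℤ) * r) - (psum u k - (k : ℤ) * r)) := by
        have : ∀ k : ℕ, (((psum u (i + k) : ℝ) - (i + k : ℤ) * r) - (psum u k - (k : ℤ) * r)) =
          (psum u (i + k) - psum u k) - i * r := by intro k; push_cast; ring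
        simp only [this]
        rw [Finset.sum_sub_distrib, Finset.sum_const, Finset.card_range, nsmul_eq_mul]
        simp only [hg]
        push_cast
        linear_combination (i : ℝ) * hr
      rw [e]
      refine (Finset.abs_sum_le_sum_abs _ _).trans ?_
      refine (Finset.sum_le_sum fun (k : ℕ) _ => hα.abs_sub_le (i + k) k).trans ?_
      simp
    exact_mod_cast h1
  have hend : ∃ N : ℤ, ∀ i : ℤ, N ≤ |i| → g (i + 1) = g i := by
    by_cases h : ∀ i, r.num ≤ psum u (i + q) - psum u i
    · exact exists_forall_eq_of_monotone_of_abs_le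
        (monotone_int_of_le_succ fun i => by linarith [hstep i, h i]) hbound
    · push Not at h
      obtain ⟨j, hj⟩ := h
      obtain ⟨N, hN⟩ := exists_forall_eq_of_monotone_of_abs_le (g := fun i => - g i)
        (monotone_int_of_le_succ fun i => by linarith [hstep i, hb q i j])
        (fun i => (abs_neg (g i)).trans_le (hbound i))
      exact ⟨N, fun i hi => neg_injective (hN i hi)⟩
  obtain ⟨N, hN⟩ := hend
  refine ⟨q, by exact_mod_cast hq0, N + 1, fun i hi => toInt_injective ?_⟩
  have h1 := hstep i
  have h2 := hstep (i + 1)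
  have h3 := hN i (by omega)
  have h4 : g (i + 1 + 1) = g (i + 1) := by
    refine hN _ ?_
    rcases abs_cases i with h | h <;> rcases abs_cases (i + 1) with h' | h' <;> omega
  rw [h3] at h1
  rw [h4, show i + 1 + (q : ℤ) = i + q + 1 by ring, psum_add_one, psum_add_one] at h2
  linarith

theorem HasSlope.mem_Ioo {x : ℤ → Bool} {α : ℝ} (h : HasSlope x α) (hα : Irrational α) :
    α ∈ Ioo 0 1 := by
  have hmono : ∀ n : ℕ, 0 ≤ psum x n ∧ psum x n ≤ n := by
    intro n
    induction n with
    | zero => simp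
    | succ n ih =>
      have := toInt_eq_zero_or_one (x n)
      push_cast
      rw [psum_add_one]
      omega
  have hb : ∀ n : ℕ, -1 ≤ n * α ∧ n * (α - 1) ≤ 1 := by
    intro n
    have h1 := abs_le.1 (h 0 n)
    have h2 : (0 : ℝ) ≤ psum x n ∧ (psum x n : ℝ) ≤ n := by exact_mod_cast hmono n
    simp only [zero_add, psum_zero, Int.cast_zero, sub_zero] at h1
    constructor <;> linarith
  have h0 : 0 ≤ α := by
    by_contra hneg
    obtain ⟨n, hn⟩ := exists_nat_gt (1 / -α)
    rw [div_lt_iff₀ (by linarith)] at hn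
    linarith [(hb n).1]
  have h1 : α ≤ 1 := by
    by_contra hgt
    obtain ⟨n, hn⟩ := exists_nat_gt (1 / (α - 1))
    rw [div_lt_iff₀ (by linarith)] at hn
    linarith [(hb n).2]
  exact ⟨h0.lt_of_ne (Ne.symm hα.ne_zero), h1.lt_of_ne hα.ne_one⟩

/-! ### The phase of a sequence and the coding of a rotation -/

/-- The phase `ρ` of a sequence of slope `α`: the number for which `psum x n = ⌊n α + ρ⌋`, up to the
ambiguity when `n α + ρ` is an integer. -/
noncomputable def phase (α : ℝ) (x : ℤ → Bool) : ℝ := ⨆ n : ℤ, ((psum x n : ℝ) - n * α)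

theorem HasSlope.bddAbove {x : ℤ → Bool} {α : ℝ} (h : HasSlope x α) :
    BddAbove (range fun n : ℤ => (psum x n : ℝ) - n * α) := by
  refine ⟨1, ?_⟩
  rintro _ ⟨n, rfl⟩
  simpa using (abs_le.1 (h.abs_sub_le n 0)).2

theorem HasSlope.psum_le {x : ℤ → Bool} {α : ℝ} (h : HasSlope x α) (n : ℤ) :
    (psum x n : ℝ) ≤ phase α x + n * α := by
  have h1 : (psum x n : ℝ) - n * α ≤ phase α x := le_ciSup h.bddAbove n
  linarith

theorem HasSlope.le_psum {x : ℤ → Bool} {α : ℝ} (h : HasSlope x α) (n : ℤ) :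
    phase α x + n * α ≤ psum x n + 1 := by
  have : phase α x ≤ psum x n - n * α + 1 :=
    ciSup_le fun m => by linarith [(abs_le.1 (h.abs_sub_le m n)).2]
  linarith

theorem HasSlope.psum_eq_floor {x : ℤ → Bool} {α : ℝ} (h : HasSlope x α) {n : ℤ}
    (hn : ∀ k : ℤ, phase α x + n * α ≠ k) : psum x n = ⌊phase α x + n * α⌋ := by
  symm
  rw [Int.floor_eq_iff]
  refine ⟨h.psum_le n, (h.le_psum n).lt_of_ne ?_⟩
  exact_mod_cast hn (psum x n + 1)

theorem psum_shift (x : ℤ → Bool) (n : ℤ) : psum (shift x) n = psum x (n + 1) - (x 0).toInt := by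
  have key : ∀ z : ℤ, psum (shift x) (z + 1) - psum x (z + 1 + 1) =
      psum (shift x) z - psum x (z + 1) := by
    intro z
    rw [psum_add_one, psum_add_one x (z + 1), shift]
    ring
  have h1 : psum x 1 = (x 0).toInt := by simpa using psum_add_one x 0
  induction n using Int.induction_on with
  | zero => simp [h1]
  | succ z ih => linarith [key z]
  | pred z ih =>
    have := key (-z - 1)
    rw [sub_add_cancel] at this ⊢
    linarith

theorem HasSlope.phase_shift {x : ℤ → Bool} {α : ℝ} (h : HasSlope x α) :
    phase α (shift x) = phase α x + α - (x 0).toInt := by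
  have e : ∀ n : ℤ, (psum (shift x) n : ℝ) - n * α =
      ((psum x (n + 1) : ℝ) - ((n + 1 : ℤ) : ℝ) * α) + (α - (x 0).toInt) := by
    intro n
    rw [psum_shift]
    push_cast
    ring
  have h1 := (Equiv.addRight (1 : ℤ)).iSup_comp (g := fun n : ℤ => (psum x n : ℝ) - n * α)
  have h2 : BddAbove (range fun n : ℤ => (psum x (n + 1) : ℝ) - ((n + 1 : ℤ) : ℝ) * α) :=
    h.bddAbove.mono (by rintro _ ⟨n, rfl⟩; exact ⟨n + 1, rfl⟩)
  simp only [Equiv.coe_addRight] at h1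
  rw [phase, phase, add_sub_assoc, ← h1, ciSup_add h2]
  simp only [e]

theorem measurable_phase (α : ℝ) : Measurable (phase α) := by
  have : ∀ n : ℤ, Measurable fun x : ℤ → Bool => (psum x n : ℝ) := by
    intro n
    have h1 : ∀ k : ℤ, Measurable fun x : ℤ → Bool => (x k).toInt := fun k =>
      (measurable_from_top (f := Bool.toInt)).comp (measurable_pi_apply k)
    exact (measurable_from_top (f := fun z : ℤ => (z : ℝ))).comp
      ((Finset.measurable_sum _ fun k _ => h1 k).sub (Finset.measurable_sum _ fun k _ => h1 k))
  exact Measurable.iSup fun n => (this n).sub_const _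

/-- The coding of the orbit of `z` under the rotation by `α` with respect to the arc
`[1 - α, 1)`. -/
noncomputable def rotationCoding (α : ℝ) (z : UnitAddCircle) : ℤ → Bool := fun n =>
  decide (1 - α ≤ (AddCircle.equivIco 1 0 (z + n • (α : UnitAddCircle)) : ℝ))

theorem rotationCoding_coe (α ρ : ℝ) (n : ℤ) :
    rotationCoding α (ρ : UnitAddCircle) n = decide (1 - α ≤ Int.fract (ρ + n * α)) := by
  have : (ρ : UnitAddCircle) + n • (α : UnitAddCircle) = ((ρ + n * α : ℝ) : UnitAddCircle) := by
    rw [AddCircle.coe_add, ← AddCircle.coe_zsmul, zsmul_eq_mul]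
  rw [rotationCoding, this, AddCircle.coe_equivIco_mk_apply]
  simp

theorem toInt_rotationCoding {α : ℝ} (hα : α ∈ Ioo 0 1) (ρ : ℝ) (n : ℤ) :
    (rotationCoding α (ρ : UnitAddCircle) n).toInt = ⌊ρ + (n + 1 : ℤ) * α⌋ - ⌊ρ + n * α⌋ := by
  rw [rotationCoding_coe]
  have h1 := Int.floor_add_fract (ρ + n * α)
  have h2 := Int.fract_nonneg (ρ + n * α)
  have h3 := Int.fract_lt_one (ρ + n * α)
  have e : ρ + (n + 1 : ℤ) * α = ρ + n * α + α := by push_cast; ring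
  rw [e]
  by_cases h : 1 - α ≤ Int.fract (ρ + n * α)
  · have : ⌊ρ + n * α + α⌋ = ⌊ρ + n * α⌋ + 1 := by
      rw [Int.floor_eq_iff]
      push_cast
      constructor <;> linarith [hα.2]
    simp [h, this]
  · have : ⌊ρ + n * α + α⌋ = ⌊ρ + n * α⌋ := by
      rw [Int.floor_eq_iff]
      constructor <;> linarith [hα.1]
    simp [h, this]

theorem shift_rotationCoding (α : ℝ) (z : UnitAddCircle) :
    shift (rotationCoding α z) = rotationCoding α (z + α) := by
  funext n
  simp only [shift, rotationCoding]
  rw [add_zsmul, one_zsmul, add_comm (n • (α : UnitAddCircle)), add_assoc]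

theorem measurable_rotationCoding (α : ℝ) : Measurable (rotationCoding α) := by
  refine measurable_pi_iff.2 fun n => measurable_to_bool ?_
  have h1 : Measurable fun z : UnitAddCircle =>
      (AddCircle.equivIco 1 0 (z + n • (α : UnitAddCircle)) : ℝ) :=
    measurable_subtype_coe.comp ((AddCircle.measurableEquivIco 1 0).measurable.comp
      (measurable_add_const _))
  convert measurableSet_le (measurable_const (a := 1 - α)) h1 using 1
  ext z
  simp [rotationCoding]

/-- A sequence is the coding of its phase, unless the orbit of the phase meets `0`. -/
theorem HasSlope.rotationCoding_phase {x : ℤ → Bool} {α : ℝ} (h : HasSlope x α)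
    (hα : α ∈ Ioo 0 1) (hρ : ∀ n k : ℤ, phase α x + n * α ≠ k) :
    rotationCoding α (phase α x : UnitAddCircle) = x := by
  funext n
  apply toInt_injective
  rw [toInt_rotationCoding hα, ← h.psum_eq_floor (hρ _), ← h.psum_eq_floor (hρ _), psum_add_one]
  ring

/-! ### The orbit closure -/

theorem mem_orbitClosure_iff {u x : ℤ → Bool} :
    x ∈ orbitClosure u ↔ ∀ m : ℕ, ∃ k : ℤ, ∀ i : ℤ, |i| ≤ m → x i = u (i + k) := by
  have key : ∀ (y : ℤ → Bool) (m : ℕ),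
      dist x y < (1 / 2 : ℝ) ^ m ↔ ∀ i : ℤ, |i| ≤ m → x i = y i := by
    intro y m
    refine (shiftDist_lt_iff x y m).trans ⟨fun h i hi => ?_, fun h k hk => ⟨h _ ?_, h _ ?_⟩⟩
    · obtain ⟨k, rfl | rfl⟩ := i.eq_nat_or_neg
      · exact (h k (by simpa using hi)).1
      · exact (h k (by simpa using hi)).2
    · simpa using hk
    · simpa using hk
  rw [orbitClosure, Metric.mem_closure_iff]
  constructor
  · intro h m
    obtain ⟨_, ⟨k, rfl⟩, hk⟩ := h ((1 / 2) ^ m) (by positivity)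
    exact ⟨k, (key _ m).1 hk⟩
  · intro h ε hε
    obtain ⟨m, hm⟩ := exists_pow_lt_of_lt_one hε (show (1 / 2 : ℝ) < 1 by norm_num)
    obtain ⟨k, hk⟩ := h m
    exact ⟨_, ⟨k, rfl⟩, ((key _ m).2 hk).trans hm⟩

theorem HasSlope.of_mem_orbitClosure {u x : ℤ → Bool} {α : ℝ} (h : HasSlope u α)
    (hx : x ∈ orbitClosure u) : HasSlope x α := by
  intro i n
  obtain ⟨k, hk⟩ := mem_orbitClosure_iff.1 hx (i.natAbs + n)
  have := psum_sub_congr (x := x) (y := u) (i := i) (j := i + k) (n := n) fun l hl => by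
    rw [hk (i + l) (by push_cast; rw [abs_le]; constructor <;> cases abs_cases i <;> omega)]
    congr 1
    ring
  have h2 := h (i + k) n
  have h3 : (psum x (i + n) : ℝ) - psum x i = psum u (i + k + n) - psum u (i + k) := by
    exact_mod_cast this
  rwa [h3]

theorem exists_int_mul_sub_mem_Ioo {α : ℝ} (hα : Irrational α) {a b : ℝ} (hab : a < b) (c : ℝ) :
    ∃ k l : ℤ, c + k * α - l ∈ Ioo a b := by
  have hd : Dense (AddSubgroup.closure {α, 1} : Set ℝ) := by
    rw [dense_addSubgroupClosure_pair_iff, div_one]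
    exact hα
  obtain ⟨y, hy, hmem⟩ := hd.exists_between (show a - c < b - c by linarith)
  obtain ⟨k, l, rfl⟩ := AddSubgroup.mem_closure_pair.1 hy
  refine ⟨k, -l, ?_⟩
  simp only [zsmul_eq_mul, mul_one, mem_Ioo, Int.cast_neg] at hmem ⊢
  constructor <;> linarith [hmem.1, hmem.2]

/-- Every coding of the rotation belongs to the orbit closure: the coding is continuous from the
right, and the orbit of the phase of `u` is dense. -/
theorem HasSlope.rotationCoding_mem {u : ℤ → Bool} {α : ℝ} (h : HasSlope u α)
    (hα : Irrational α) (z : UnitAddCircle) : rotationCoding α z ∈ orbitClosure u := by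
  have hα01 := h.mem_Ioo hα
  induction z using QuotientAddGroup.induction_on with | _ ρ
  rw [mem_orbitClosure_iff]
  intro m
  obtain ⟨δ, hδ, hfl⟩ : ∃ δ > 0, ∀ n : ℤ, |n| ≤ m + 1 → Int.fract (ρ + n * α) + δ ≤ 1 := by
    obtain ⟨n₀, -, hn₀⟩ := (Finset.Icc (-(m + 1) : ℤ) (m + 1)).exists_max_image
      (fun n : ℤ => Int.fract (ρ + n * α)) ⟨0, by simp; omega⟩
    refine ⟨1 - Int.fract (ρ + n₀ * α), by linarith [Int.fract_lt_one (ρ + n₀ * α)], fun n hn => ?_⟩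
    linarith [hn₀ n (by rw [Finset.mem_Icc]; exact abs_le.1 hn)]
  obtain ⟨k, l, hkl⟩ := exists_int_mul_sub_mem_Ioo hα (show ρ < ρ + δ by linarith) (phase α u)
  have key : ∀ n : ℤ, |n| ≤ m + 1 → psum u (n + k) = ⌊ρ + n * α⌋ + l := by
    intro n hn
    have h1 := h.psum_le (n + k)
    have h2 := h.le_psum (n + k)
    have h3 := Int.floor_add_fract (ρ + n * α)
    have h4 := Int.fract_nonneg (ρ + n * α)
    have h5 := hfl n hn
    have h6 := hkl.1
    have h7 := hkl.2
    push_cast at h1 h2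
    have h8 : psum u (n + k) < ⌊ρ + n * α⌋ + l + 1 := by
      have : (psum u (n + k) : ℝ) < ⌊ρ + n * α⌋ + l + 1 := by linarith
      exact_mod_cast this
    have h9 : ⌊ρ + n * α⌋ + l < psum u (n + k) + 1 := by
      have : (⌊ρ + n * α⌋ + l : ℝ) < psum u (n + k) + 1 := by linarith
      exact_mod_cast this
    omega
  refine ⟨k, fun i hi => toInt_injective ?_⟩
  have h1 := key i (by omega)
  have h2 := key (i + 1) (by have := abs_add_le i 1; simp at this; omega)
  rw [show i + 1 + k = i + k + 1 by ring, psum_add_one] at h2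
  have h3 := toInt_rotationCoding hα01 ρ i
  change (rotationCoding α (ρ : UnitAddCircle) i).toInt = _
  linarith

/-! ### Unique ergodicity -/

instance isProbabilityMeasure_volume_unitAddCircle :
    IsProbabilityMeasure (volume : Measure UnitAddCircle) := ⟨UnitAddCircle.measure_univ⟩

/-- An irrational rotation of the circle is uniquely ergodic: a measure invariant under a dense set
of translations is a Haar measure. -/
theorem eq_volume_of_map_add_irrational {α : ℝ} (hα : Irrational α) (ν : Measure UnitAddCircle)
    [IsProbabilityMeasure ν] (h : ν.map (· + (α : UnitAddCircle)) = ν) : ν = volume := by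
  have hz : ∀ n : ℤ, ν.map (· + n • (α : UnitAddCircle)) = ν := by
    have key : ∀ n : ℤ, ν.map (· + (n + 1) • (α : UnitAddCircle)) =
        ν.map (· + n • (α : UnitAddCircle)) := by
      intro n
      conv_rhs => rw [← h, Measure.map_map (measurable_add_const _) (measurable_add_const _)]
      congr 1
      funext z
      simp only [Function.comp, add_zsmul, one_zsmul]
      abel
    intro n
    induction n using Int.induction_on with
    | zero => simp
    | succ z ih => rw [key, ih]
    | pred z ih => rw [← key, sub_add_cancel, ih]
  have hd : DenseRange fun n : ℤ => n • (α : UnitAddCircle) := by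
    rw [AddCircle.denseRange_zsmul_coe_iff, div_one]
    exact hα
  have hf : ∀ (f : BoundedContinuousFunction UnitAddCircle ℝ) (t : UnitAddCircle),
      ∫ x, f (x + t) ∂ν = ∫ x, f x ∂ν := by
    intro f
    have hc : Continuous fun t => ∫ x, f (x + t) ∂ν := by
      refine continuous_of_dominated (bound := fun _ => ‖f‖)
        (fun t => (f.continuous.comp (continuous_add_const t)).aestronglyMeasurable)
        (fun t => ae_of_all _ fun x => f.norm_coe_le_norm _) (integrable_const _)
        (ae_of_all _ fun x => f.continuous.comp (continuous_const_add x))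
    refine fun t => congrFun (hd.equalizer hc continuous_const (funext fun n => ?_)) t
    change ∫ x, f (x + n • (α : UnitAddCircle)) ∂ν = ∫ x, f x ∂ν
    conv_rhs => rw [← hz n]
    rw [integral_map (measurable_add_const _).aemeasurable f.continuous.aestronglyMeasurable]
  have hinv : ν.IsAddLeftInvariant := by
    refine ⟨fun t => ?_⟩
    have := (Measure.isProbabilityMeasure_map (μ := ν) (measurable_const_add t).aemeasurable)
    refine ext_of_forall_integral_eq_of_IsFiniteMeasure fun f => ?_
    rw [integral_map (measurable_const_add t).aemeasurable f.continuous.aestronglyMeasurable,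
      ← hf f t]
    simp only [add_comm]
  have := Measure.isAddLeftInvariant_eq_smul ν volume
  have h1 : Measure.addHaarScalarFactor ν volume = 1 := by
    have h2 := congrArg (fun μ : Measure UnitAddCircle => μ univ) this
    simpa using h2.symm
  rw [this, h1, one_smul]

theorem measurable_subshift (u : ℤ → Bool) : Measurable (subshift u) :=
  ((measurable_pi_iff.2 fun i => (measurable_pi_apply (i + 1)).comp
    measurable_subtype_coe : Measurable fun x : orbitClosure u => shift x)).subtype_mk

/-- The coding of the rotation, as a map into the orbit closure. -/
noncomputable def codingMap {u : ℤ → Bool} {α : ℝ} (h : HasSlope u α) (hα : Irrational α)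
    (z : UnitAddCircle) : orbitClosure u :=
  ⟨rotationCoding α z, h.rotationCoding_mem hα z⟩

section

variable {u : ℤ → Bool} {α : ℝ} (h : HasSlope u α) (hα : Irrational α)

theorem measurable_codingMap : Measurable (codingMap h hα) :=
  (measurable_rotationCoding α).subtype_mk

theorem subshift_codingMap (z : UnitAddCircle) :
    subshift u (codingMap h hα z) = codingMap h hα (z + α) :=
  Subtype.ext (shift_rotationCoding α z)

theorem iterate_subshift_codingMap (n : ℕ) (z : UnitAddCircle) :
    (subshift u)^[n] (codingMap h hα z) = codingMap h hα (z + n • (α : UnitAddCircle)) := by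
  induction n generalizing z with
  | zero => simp
  | succ n ih =>
    rw [Function.iterate_succ_apply, subshift_codingMap, ih, add_nsmul, one_nsmul]
    congr 1
    abel

theorem measurePreserving_subshift_map_codingMap :
    MeasurePreserving (subshift u) (Measure.map (codingMap h hα) volume)
      (Measure.map (codingMap h hα) volume) := by
  refine ⟨measurable_subshift u, ?_⟩
  have hc := measurable_codingMap h hα
  rw [Measure.map_map (measurable_subshift u) hc]
  have : subshift u ∘ codingMap h hα = codingMap h hα ∘ (· + (α : UnitAddCircle)) :=
    funext (subshift_codingMap h hα)
  rw [this, ← Measure.map_map hc (measurable_add_const _), map_add_right_eq_self]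

/-- Every invariant measure is the distribution of the coding of a uniformly distributed point: its
image under the phase is rotation invariant, and the phase determines almost every sequence. -/
theorem eq_map_codingMap (μ : Measure (orbitClosure u)) [IsProbabilityMeasure μ]
    (hμ : MeasurePreserving (subshift u) μ μ) : μ = Measure.map (codingMap h hα) volume := by
  have hc := measurable_codingMap h hα
  set φ : orbitClosure u → UnitAddCircle := fun x => (phase α x : UnitAddCircle) with hφ
  have hφm : Measurable φ :=
    AddCircle.measurable_mk'.comp ((measurable_phase α).comp measurable_subtype_coe)
  have hφs : φ ∘ subshift u = (· + (α : UnitAddCircle)) ∘ φ := by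
    funext x
    have h1 : phase α (subshift u x : ℤ → Bool) = phase α x + α - ((x : ℤ → Bool) 0).toInt :=
      (h.of_mem_orbitClosure x.2).phase_shift
    have h2 : ((((x : ℤ → Bool) 0).toInt : ℝ) : UnitAddCircle) = 0 :=
      (AddCircle.coe_eq_zero_iff 1).2 ⟨((x : ℤ → Bool) 0).toInt, by simp⟩
    simp only [Function.comp, hφ, h1]
    rw [AddCircle.coe_sub, AddCircle.coe_add, h2, sub_zero]
  have hν : μ.map φ = volume := by
    have := Measure.isProbabilityMeasure_map (μ := μ) hφm.aemeasurable
    apply eq_volume_of_map_add_irrational hα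
    rw [Measure.map_map (measurable_add_const _) hφm, ← hφs, ← Measure.map_map hφm hμ.measurable,
      hμ.map_eq]
  have hae : ∀ᵐ z : UnitAddCircle, ∀ n : ℤ, z + n • (α : UnitAddCircle) ≠ 0 := by
    rw [ae_all_iff]
    intro n
    have : ∀ᵐ z : UnitAddCircle, z ≠ -(n • (α : UnitAddCircle)) := by
      rw [ae_iff]
      have := AddCircle.volume_closedBall (T := 1) (x := -(n • (α : UnitAddCircle))) 0
      simpa [Metric.closedBall_zero] using this
    filter_upwards [this] with z hz h0
    exact hz (eq_neg_of_add_eq_zero_left h0)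
  rw [← hν] at hae
  have hid : codingMap h hα ∘ φ =ᵐ[μ] id := by
    filter_upwards [ae_of_ae_map hφm.aemeasurable hae] with x hx
    refine Subtype.ext ((h.of_mem_orbitClosure x.2).rotationCoding_phase (h.mem_Ioo hα)
      fun n k hk => hx n ?_)
    rw [hφ, ← AddCircle.coe_zsmul, ← AddCircle.coe_add, zsmul_eq_mul, hk]
    exact (AddCircle.coe_eq_zero_iff 1).2 ⟨k, by simp⟩
  rw [← hν, Measure.map_map hc hφm, Measure.map_congr hid, Measure.map_id]

end

theorem existsUnique_invariant {u : ℤ → Bool} {α : ℝ} (h : HasSlope u α) (hα : Irrational α) :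
    ∃! μ : ProbabilityMeasure (orbitClosure u),
      MeasurePreserving (subshift u) (μ : Measure _) (μ : Measure _) := by
  refine ⟨⟨Measure.map (codingMap h hα) volume,
    Measure.isProbabilityMeasure_map (measurable_codingMap h hα).aemeasurable⟩,
    measurePreserving_subshift_map_codingMap h hα, fun μ hμ => Subtype.ext ?_⟩
  exact eq_map_codingMap h hα μ hμ

/-! ### Measures of cylinders -/

/-- If `r` is a rational approximation of `α` of denominator `q` with error less than `1 / q ^ 2`,
then two phases at distance more than `3 / q` are separated by one of the first `q` points of the
backward orbit of `0`, because these points are `1 / q`-close to the multiples of `1 / q`. -/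
theorem sub_le_of_rotationCoding_eq {α : ℝ} (hα : α ∈ Ioo 0 1) {r : ℚ}
    (hr : |α - r| < 1 / (r.den : ℝ) ^ 2) {ρ ρ' : ℝ} (hρ : ρ ∈ Ioo 0 1) (hρ' : ρ' ∈ Ioo 0 1)
    (h : ∀ j : ℕ, j < r.den → rotationCoding α ρ j = rotationCoding α ρ' j) :
    ρ' - ρ ≤ 3 / r.den := by
  have hfl : ∀ j : ℕ, j ≤ r.den → ⌊ρ + (j : ℤ) * α⌋ = ⌊ρ' + (j : ℤ) * α⌋ := by
    intro j
    induction j with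
    | zero =>
      intro _
      simp only [Nat.cast_zero, Int.cast_zero, zero_mul, add_zero]
      rw [Int.floor_eq_zero_iff.2 ⟨hρ.1.le, hρ.2⟩, Int.floor_eq_zero_iff.2 ⟨hρ'.1.le, hρ'.2⟩]
    | succ j ih =>
      intro hj
      have h1 := toInt_rotationCoding hα ρ j
      have h2 := toInt_rotationCoding hα ρ' j
      rw [h j (by omega)] at h1
      have h3 := ih (by omega)
      push_cast at h1 h2 h3 ⊢
      linarith
  by_contra! hlt
  set q := r.den with hq
  have hq0 : (0 : ℝ) < q := by exact_mod_cast r.pos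
  have hrq : (r : ℝ) = r.num / q := by exact_mod_cast (Rat.num_div_den r).symm
  -- A multiple `a / q` of `1 / q` well inside `(ρ, ρ')`, and `j < q` with `a + j p ≡ 0` modulo `q`.
  set a : ℤ := ⌈q * ρ⌉ + 1 with ha
  have ha1 : q * ρ + 1 ≤ a := by rw [ha]; push_cast; linarith [Int.le_ceil (q * ρ)]
  have ha2 : (a : ℝ) < q * ρ' - 1 := by
    rw [ha]
    push_cast
    rw [div_lt_iff₀ hq0] at hlt
    linarith [Int.ceil_lt_add_one (q * ρ)]
  obtain ⟨j, hj, l, hl⟩ : ∃ j : ℕ, j < q ∧ ∃ l : ℤ, a + j * r.num = l * q := by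
    obtain ⟨s, t, hst⟩ : IsCoprime r.num (q : ℤ) :=
      Int.isCoprime_iff_gcd_eq_one.2 (by simpa [Int.gcd] using r.reduced)
    have hq0' : (0 : ℤ) < q := by exact_mod_cast r.pos
    have hm := Int.emod_nonneg (-a * s) hq0'.ne'
    have hm' := Int.emod_lt_of_pos (-a * s) hq0'
    refine ⟨(-a * s % q).toNat, by omega, a * t - (-a * s / q) * r.num, ?_⟩
    rw [Int.toNat_of_nonneg hm]
    have h4 := Int.emod_add_mul_ediv (-a * s) q
    linear_combination r.num * h4 - a * hst
  have hl' : (a : ℝ) + j * r.num = l * q := by exact_mod_cast hl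
  have hjα : |j * α - j * r| < 1 / q := by
    rw [← mul_sub, abs_mul, Nat.abs_cast]
    have hjq : (j : ℝ) ≤ q := by exact_mod_cast hj.le
    calc (j : ℝ) * |α - r| ≤ q * |α - r| := by gcongr
      _ < q * (1 / (q : ℝ) ^ 2) := by gcongr
      _ = 1 / q := by field_simp
  have hjr : (l : ℝ) - j * r = a / q := by
    rw [hrq]
    field_simp
    linarith
  have h1 : ρ + 1 / q ≤ a / q := by
    rw [le_div_iff₀ hq0, add_mul, div_mul_cancel₀ _ hq0.ne']
    linarith
  have h2 : a / q < ρ' - 1 / q := by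
    rw [div_lt_iff₀ hq0, sub_mul, div_mul_cancel₀ _ hq0.ne']
    linarith
  rw [abs_lt] at hjα
  have h3 := hfl j hj.le
  have h4 : ⌊ρ + (j : ℤ) * α⌋ < l := by
    rw [Int.floor_lt]
    push_cast
    linarith
  have h5 : l ≤ ⌊ρ' + (j : ℤ) * α⌋ := by
    rw [Int.le_floor]
    push_cast
    linarith
  omega

theorem measurableSet_cylinder (w : ℤ → Bool) (n : ℕ) :
    MeasurableSet {x : ℤ → Bool | ∀ j : ℕ, j < n → x j = w j} := by
  have : {x : ℤ → Bool | ∀ j : ℕ, j < n → x j = w j} =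
      ⋂ (j : ℕ) (_ : j < n), (fun x : ℤ → Bool => x j) ⁻¹' {w j} := by
    ext; simp
  rw [this]
  exact MeasurableSet.iInter fun j => MeasurableSet.iInter fun _ =>
    measurable_pi_apply (j : ℤ) (measurableSet_singleton _)

theorem volume_rotationCoding_cylinder_le {α : ℝ} (hα : α ∈ Ioo 0 1) {r : ℚ}
    (hr : |α - r| < 1 / (r.den : ℝ) ^ 2) (w : ℤ → Bool) :
    volume {z : UnitAddCircle | ∀ j : ℕ, j < r.den → rotationCoding α z j = w j} ≤
      ENNReal.ofReal (3 / r.den) := by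
  have hm : MeasurableSet
      {z : UnitAddCircle | ∀ j : ℕ, j < r.den → rotationCoding α z j = w j} :=
    measurable_rotationCoding α (measurableSet_cylinder w r.den)
  rw [AddCircle.add_projection_respects_measure 1 0 hm]
  set S : Set ℝ := QuotientAddGroup.mk ⁻¹'
    {z : UnitAddCircle | ∀ j : ℕ, j < r.den → rotationCoding α z j = w j} with hS
  calc volume (S ∩ Ioc 0 (0 + 1)) ≤ volume (S ∩ Ioo 0 1 ∪ {1}) := by
        refine measure_mono ?_
        rintro x ⟨h1, h2, h3⟩
        rw [zero_add] at h3
        rcases h3.lt_or_eq with h | h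
        · exact Or.inl ⟨h1, h2, h⟩
        · exact Or.inr h
    _ ≤ volume (S ∩ Ioo 0 1) + volume {(1 : ℝ)} := measure_union_le _ _
    _ = volume (S ∩ Ioo 0 1) := by simp
    _ ≤ Metric.ediam (S ∩ Ioo 0 1) := Real.volume_le_diam _
    _ ≤ ENNReal.ofReal (3 / r.den) := by
        refine Metric.ediam_le ?_
        rintro x ⟨hx, hx'⟩ y ⟨hy, hy'⟩
        rw [edist_dist]
        refine ENNReal.ofReal_le_ofReal ?_
        rw [Real.dist_eq, abs_sub_le_iff]
        exact ⟨sub_le_of_rotationCoding_eq hα hr hy' hx' fun j hj => (hy j hj).trans (hx j hj).symm,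
          sub_le_of_rotationCoding_eq hα hr hx' hy' fun j hj => (hx j hj).trans (hy j hj).symm⟩

theorem exists_rat_approx_le_den {α : ℝ} (hα : Irrational α) (N : ℕ) :
    ∃ r : ℚ, N ≤ r.den ∧ |α - r| < 1 / (r.den : ℝ) ^ 2 := by
  by_contra! hno
  refine Real.infinite_rat_abs_sub_lt_one_div_den_sq_of_irrational hα ?_
  have hfin : (Icc (-((N : ℤ) * (⌈|α|⌉ + 1))) ((N : ℤ) * (⌈|α|⌉ + 1)) ×ˢ Iio N).Finite :=
    (Set.finite_Icc _ _).prod (Set.finite_Iio _)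
  refine Finite.of_finite_image (f := fun r : ℚ => (r.num, r.den)) (hfin.subset ?_) ?_
  · rintro _ ⟨r, hr, rfl⟩
    rw [mem_ofPred_eq] at hr
    have hden : r.den < N := by
      by_contra h
      exact absurd hr (not_lt.2 (hno r (not_lt.1 h)))
    refine ⟨?_, hden⟩
    have hd1 : (1 : ℝ) ≤ r.den := by exact_mod_cast r.pos
    have h1 : |α - r| < 1 := hr.trans_le (by
      rw [div_le_one (by positivity)]
      nlinarith)
    have h2 : |(r : ℝ)| ≤ ⌈|α|⌉ + 1 := by
      have := abs_sub_abs_le_abs_sub (r : ℝ) α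
      rw [abs_sub_comm] at h1
      linarith [Int.le_ceil |α|]
    have h3 : ((r.num : ℤ) : ℝ) = r.den * r := by
      exact_mod_cast (Rat.den_mul_eq_num r).symm
    have h4 : |((r.num : ℤ) : ℝ)| ≤ N * (⌈|α|⌉ + 1) := by
      rw [h3, abs_mul, Nat.abs_cast]
      have : (r.den : ℝ) ≤ N := by exact_mod_cast hden.le
      gcongr
    rw [mem_Icc, ← abs_le]
    exact_mod_cast h4
  · intro r _ s _ h
    simp only [Prod.mk.injEq] at h
    exact Rat.ext h.1 h.2

/-! ### The lower bound for the semi-topological entropy -/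

theorem iterate_subshift_apply {u : ℤ → Bool} (n : ℕ) (x : orbitClosure u) (i : ℤ) :
    ((subshift u)^[n] x : ℤ → Bool) i = (x : ℤ → Bool) (i + n) := by
  induction n generalizing x with
  | zero => simp
  | succ n ih =>
    rw [Function.iterate_succ_apply, ih]
    change (x : ℤ → Bool) (i + n + 1) = _
    push_cast
    rw [add_assoc]

theorem bowenBall_subset_cylinder {u : ℤ → Bool} {ε : ℝ} (hε : ε ≤ 1) (n : ℕ)
    (x : orbitClosure u) : bowenBall (subshift u) n x ε ⊆
      {y | ∀ j : ℕ, j < n → (y : ℤ → Bool) j = (x : ℤ → Bool) j} := by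
  intro y hy j hj
  have h1 : shiftDist ((subshift u)^[j] x) ((subshift u)^[j] y) < (1 / 2 : ℝ) ^ 0 := by
    rw [pow_zero]
    exact (hy j hj).trans_le hε
  have h2 := ((shiftDist_lt_iff _ _ 0).1 h1 0 le_rfl).1
  rw [iterate_subshift_apply, iterate_subshift_apply] at h2
  simpa using h2.symm

theorem le_semitopNumber {u : ℤ → Bool} {α : ℝ} (h : HasSlope u α) (hα : Irrational α) {r : ℚ}
    (hr : |α - r| < 1 / (r.den : ℝ) ^ 2) {ε : ℝ} (hε : ε ≤ 1 / 2) :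
    (r.den : ℝ≥0∞) / 6 ≤
      semitopNumber (Measure.map (codingMap h hα) volume) (subshift u) ε r.den := by
  set μ := Measure.map (codingMap h hα) volume with hμ
  have hprob : IsProbabilityMeasure μ :=
    Measure.isProbabilityMeasure_map (measurable_codingMap h hα).aemeasurable
  refine le_iInf₂ fun F hF => ?_
  have hq0 : (0 : ℝ) < r.den := by exact_mod_cast r.pos
  have hball : ∀ x, μ.real (bowenBall (subshift u) r.den x ε) ≤ 3 / r.den := by
    intro x
    refine (measureReal_mono (bowenBall_subset_cylinder (by linarith) _ x)).trans ?_
    refine ENNReal.toReal_le_of_le_ofReal (by positivity) ?_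
    have hm : MeasurableSet
        {y : orbitClosure u | ∀ j : ℕ, j < r.den → (y : ℤ → Bool) j = (x : ℤ → Bool) j} :=
      measurable_subtype_coe (measurableSet_cylinder x r.den)
    rw [hμ, Measure.map_apply (measurable_codingMap h hα) hm]
    exact volume_rotationCoding_cylinder_le (h.mem_Ioo hα) hr x
  have h1 : 1 / 2 < F.card * (3 / (r.den : ℝ)) := by
    calc (1 / 2 : ℝ) ≤ 1 - ε := by linarith
      _ < _ := hF
      _ ≤ ∑ x ∈ F, μ.real (bowenBall (subshift u) r.den x ε) := measureReal_biUnion_finset_le _ _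
      _ ≤ ∑ x ∈ F, 3 / (r.den : ℝ) := Finset.sum_le_sum fun x _ => hball x
      _ = _ := by rw [Finset.sum_const, nsmul_eq_mul]
  have h2 : (r.den : ℝ) < F.card * 6 := by
    rw [← mul_div_assoc, lt_div_iff₀ hq0] at h1
    linarith
  refine ENNReal.div_le_of_le_mul ?_
  exact_mod_cast h2.le

theorem one_le_semitopSlowEntropy {u : ℤ → Bool} {α : ℝ} (h : HasSlope u α) (hα : Irrational α) :
    1 ≤ semitopSlowEntropy polynomialScale (Measure.map (codingMap h hα) volume) (subshift u) := by
  refine le_limsup_of_frequently_le (Eventually.frequently ?_)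
  filter_upwards [Ioo_mem_nhdsGT (show (0 : ℝ) < 1 / 2 by norm_num)] with ε hε
  refine le_iSup₂_of_le (1 : ℝ≥0) ?_ le_rfl
  refine lt_of_lt_of_le (show (0 : ℝ≥0∞) < 1 / 6 by simp) ?_
  refine le_limsup_of_frequently_le ?_
  rw [frequently_atTop]
  intro N
  obtain ⟨r, hrN, hr⟩ := exists_rat_approx_le_den hα N
  refine ⟨r.den, hrN, ?_⟩
  have hscale : ENNReal.ofReal (polynomialScale 1 r.den) = r.den := by
    simp [polynomialScale]
  rw [hscale, ENNReal.le_div_iff_mul_le (Or.inl (by simp)) (Or.inl (by simp)), mul_comm,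
    mul_one_div]
  exact le_semitopNumber h hα hr hε.2.le

/-! ### The upper bound for the topological entropy -/

theorem growthExponent_polynomialScale_le {N : ℕ → ℝ≥0∞} (d : ℝ≥0) (C : ℝ)
    (hN : ∀ n : ℕ, 1 ≤ n → N n ≤ ENNReal.ofReal (C * (n : ℝ) ^ (d : ℝ))) :
    growthExponent polynomialScale N ≤ d := by
  refine iSup₂_le fun χ hχ => ?_
  by_contra! hlt
  have hlt' : (0 : ℝ) < χ - d := by
    have : d < χ := by exact_mod_cast hlt
    simpa using this
  refine hχ.ne' (le_antisymm ?_ zero_le)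
  have hlim :
      Tendsto (fun n : ℕ => ENNReal.ofReal (C * (n : ℝ) ^ (-((χ : ℝ) - d)))) atTop (𝓝 0) := by
    rw [← ENNReal.ofReal_zero, ← mul_zero C]
    exact ENNReal.tendsto_ofReal
      (((tendsto_rpow_neg_atTop hlt').comp tendsto_natCast_atTop_atTop).const_mul C)
  rw [← hlim.limsup_eq]
  refine limsup_le_limsup ?_
  filter_upwards [eventually_ge_atTop 1] with n hn
  have hn0 : (0 : ℝ) < n := by exact_mod_cast hn
  have hpos : 0 < polynomialScale χ n := Real.rpow_pos_of_pos hn0 _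
  refine (ENNReal.div_le_div_right (hN n hn) _).trans ?_
  rw [← ENNReal.ofReal_div_of_pos hpos]
  refine ENNReal.ofReal_le_ofReal (le_of_eq ?_)
  rw [polynomialScale, mul_div_assoc, ← Real.rpow_sub hn0]
  congr 2
  ring

/-- Points with the same factor on `[-m, n + m)` are `(ε, n)`-close if `(1 / 2) ^ m < ε`. -/
theorem mem_bowenBall_of_factor_eq {u : ℤ → Bool} {m n : ℕ} {ε : ℝ} (hm : (1 / 2 : ℝ) ^ m < ε)
    {x y : orbitClosure u}
    (h : factor (x : ℤ → Bool) (n + 2 * m) (-m) = factor y (n + 2 * m) (-m)) :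
    y ∈ bowenBall (subshift u) n x ε := by
  intro i hi
  refine lt_trans ((shiftDist_lt_iff _ _ m).2 fun k hk => ?_) hm
  rw [factor_eq_iff] at h
  simp only [iterate_subshift_apply]
  have h1 := h (m + k + i) (by omega)
  have h2 := h (m - k + i) (by omega)
  have e1 : -(m : ℤ) + (m + k + i : ℕ) = k + i := by push_cast; ring
  have e2 : -(m : ℤ) + (m - k + i : ℕ) = -k + i := by omega
  rw [e1] at h1
  rw [e2] at h2
  exact ⟨h1, h2⟩

theorem coverNumber_le {u : ℤ → Bool} (hu : IsSturmian u) (K : Set (orbitClosure u)) {m : ℕ} {ε : ℝ}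
    (hm : (1 / 2 : ℝ) ^ m < ε) {n : ℕ} (hn : 1 ≤ n) :
    coverNumber (subshift u) K ε n ≤ (n + 2 * m + 1 : ℕ) := by
  classical
  set φ : orbitClosure u → Fin (n + 2 * m) → Bool := fun x => factor x (n + 2 * m) (-m) with hφ
  have hne : Nonempty (orbitClosure u) := ⟨u, subset_closure ⟨0, by simp⟩⟩
  have hsub : range φ ⊆ range (factor u (n + 2 * m)) := by
    rintro _ ⟨x, rfl⟩
    obtain ⟨k, hk⟩ := mem_orbitClosure_iff.1 x.2 (n + m)
    refine ⟨-m + k, factor_eq_iff.2 fun l hl => ?_⟩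
    rw [hk (-m + l) (by rw [abs_le]; omega)]
    congr 1
    ring
  set F : Finset (orbitClosure u) := (toFinite (range φ)).toFinset.image (Function.invFun φ) with hF
  have hcard : F.card ≤ n + 2 * m + 1 := by
    calc F.card ≤ (toFinite (range φ)).toFinset.card := Finset.card_image_le
      _ = (range φ).ncard := (ncard_eq_toFinset_card _ _).symm
      _ ≤ (range (factor u (n + 2 * m))).ncard := ncard_le_ncard hsub (toFinite _)
      _ = n + 2 * m + 1 := hu.1 (n + 2 * m) (by omega)
  refine (iInf₂_le F fun y _ => ?_).trans (by exact_mod_cast hcard)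
  refine mem_iUnion₂.2 ⟨Function.invFun φ (φ y), Finset.mem_image_of_mem _ (by simp), ?_⟩
  exact mem_bowenBall_of_factor_eq hm (Function.invFun_eq (f := φ) ⟨y, rfl⟩)

theorem topSlowEntropy_le_one {u : ℤ → Bool} (hu : IsSturmian u) :
    topSlowEntropy polynomialScale (subshift u) ≤ 1 := by
  refine iSup₂_le fun K _ => ?_
  refine (limsup_le_of_le (h := ?_) : limsup _ _ ≤ (1 : ℝ≥0∞))
  filter_upwards [self_mem_nhdsWithin] with ε hε
  obtain ⟨m, hm⟩ := exists_pow_lt_of_lt_one (mem_Ioi.1 hε) (show (1 / 2 : ℝ) < 1 by norm_num)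
  refine growthExponent_polynomialScale_le 1 (2 * m + 2) fun n hn => ?_
  refine (coverNumber_le hu K hm hn).trans ?_
  rw [← ENNReal.ofReal_natCast]
  refine ENNReal.ofReal_le_ofReal ?_
  have hn' : (1 : ℝ) ≤ n := by exact_mod_cast hn
  have hm' : (0 : ℝ) ≤ m := by positivity
  push_cast
  rw [Real.rpow_one]
  nlinarith

theorem semitopSlowEntropy_le_topSlowEntropy {X : Type*} [MetricSpace X] [CompactSpace X]
    [MeasurableSpace X] (a : ℝ≥0 → ℕ → ℝ) (μ : Measure X) [IsProbabilityMeasure μ] (f : X → X) :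
    semitopSlowEntropy a μ f ≤ topSlowEntropy a f := by
  refine le_iSup₂_of_le univ isCompact_univ (limsup_le_limsup ?_)
  filter_upwards [self_mem_nhdsWithin] with ε hε
  refine growthExponent_mono a fun n => biInf_mono fun F hF => ?_
  rw [univ_subset_iff.1 hF, probReal_univ]
  linarith [mem_Ioi.1 hε]

instance compactSpace_orbitClosure (u : ℤ → Bool) : CompactSpace (orbitClosure u) :=
  isCompact_iff_compactSpace.1 isClosed_closure.isCompact

/-! ### Hamming distances -/

section Hamming

variable {X : Type*} {k : ℕ} (f : X → X) (P : X → Fin k)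

theorem hammingDistance_eq {n : ℕ} (hn : 1 ≤ n) (x y : X) :
    hammingDistance f P n x y =
      ((Finset.range n).filter fun s => P (f^[s] x) ≠ P (f^[s] y)).card / (n : ℝ) := by
  have h := Finset.card_filter_add_card_filter_not (s := Finset.range n)
    (fun s => P (f^[s] x) = P (f^[s] y))
  rw [Finset.card_range] at h
  have h' : (((Finset.range n).filter fun s => P (f^[s] x) = P (f^[s] y)).card : ℝ) +
      ((Finset.range n).filter fun s => P (f^[s] x) ≠ P (f^[s] y)).card = n := by exact_mod_cast h
  have hn' : (0 : ℝ) < n := by exact_mod_cast hn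
  rw [hammingDistance]
  field_simp
  linarith

theorem hammingDistance_self {n : ℕ} (hn : 1 ≤ n) (x : X) : hammingDistance f P n x x = 0 := by
  simp [hammingDistance_eq f P hn]

theorem hammingDistance_comm (n : ℕ) (x y : X) :
    hammingDistance f P n x y = hammingDistance f P n y x := by
  simp only [hammingDistance, eq_comm]

theorem hammingDistance_triangle {n : ℕ} (hn : 1 ≤ n) (x y z : X) :
    hammingDistance f P n x z ≤ hammingDistance f P n x y + hammingDistance f P n y z := by
  simp only [hammingDistance_eq f P hn]
  rw [← add_div]
  gcongr
  norm_cast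
  refine le_trans (Finset.card_le_card ?_) (Finset.card_union_le _ _)
  intro s hs
  simp only [Finset.mem_union, Finset.mem_filter] at hs ⊢
  by_cases h : P (f^[s] x) = P (f^[s] y)
  · exact Or.inr ⟨hs.1, h ▸ hs.2⟩
  · exact Or.inl ⟨hs.1, h⟩

theorem measurable_hammingDistance [MeasurableSpace X] {Y : Type*} [MeasurableSpace Y]
    {f : X → X} {P : X → Fin k} (hf : Measurable f) (hP : Measurable P) (n : ℕ) {g h : Y → X}
    (hg : Measurable g) (hh : Measurable h) :
    Measurable fun y => hammingDistance f P n (g y) (h y) := by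
  have e : ∀ y, hammingDistance f P n (g y) (h y) =
      1 - (∑ s ∈ Finset.range n, {y | P (f^[s] (g y)) = P (f^[s] (h y))}.indicator
        (fun _ => (1 : ℝ)) y) / n := by
    intro y
    rw [hammingDistance, Finset.card_filter]
    push_cast
    simp only [indicator_apply, mem_ofPred_eq]
  simp only [e]
  refine measurable_const.sub ((Finset.measurable_sum _ fun s _ => ?_).div_const _)
  exact measurable_const.indicator (measurableSet_eq_fun
    (hP.comp ((hf.iterate s).comp hg)) (hP.comp ((hf.iterate s).comp hh)))

end Hamming

/-- If every point of `Y` has an `η`-ball of measure at least `c`, then `Y` is covered by at most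
`1 / c` balls of radius `2 η`: those around a maximal `2 η`-separated subset of `Y`. -/
theorem exists_finset_cover_of_le_measureReal_ball {Ω : Type*} [MeasurableSpace Ω] (μ : Measure Ω)
    [IsProbabilityMeasure μ] (D : Ω → Ω → ℝ) (hself : ∀ x, D x x = 0)
    (hcomm : ∀ x y, D x y = D y x) (htri : ∀ x y z, D x z ≤ D x y + D y z)
    (hmeas : ∀ x, Measurable (D x)) {η c : ℝ} (hη : 0 < η) (hc : 0 < c) {Y : Set Ω}
    (hY : ∀ x ∈ Y, c ≤ μ.real {y | D x y < η}) :
    ∃ F : Finset Ω, F.card ≤ ⌊1 / c⌋₊ ∧ Y ⊆ ⋃ x ∈ F, {y | D x y < 2 * η} := by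
  classical
  have hbound : ∀ F : Finset Ω, (F : Set Ω) ⊆ Y →
      (∀ x ∈ F, ∀ y ∈ F, x ≠ y → 2 * η ≤ D x y) → F.card ≤ ⌊1 / c⌋₊ := by
    intro F hFY hF
    have hdisj : PairwiseDisjoint (F : Set Ω) fun x => {y | D x y < η} := by
      intro x hx y hy hxy
      refine Set.disjoint_left.2 fun z hz hz' => ?_
      have h1 := hF x hx y hy hxy
      have h2 := htri x z y
      rw [hcomm z y] at h2
      simp only [mem_ofPred_eq] at hz hz'
      linarith
    have h1 := measureReal_biUnion_finset (μ := μ) hdisj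
      (fun x _ => measurableSet_lt (hmeas x) measurable_const)
    have h2 : F.card * c ≤ 1 := by
      calc F.card * c = ∑ x ∈ F, c := by rw [Finset.sum_const, nsmul_eq_mul]
        _ ≤ ∑ x ∈ F, μ.real {y | D x y < η} := Finset.sum_le_sum fun x hx => hY x (hFY hx)
        _ = _ := h1.symm
        _ ≤ 1 := measureReal_le_one
    refine Nat.le_floor ?_
    rwa [le_div_iff₀ hc]
  by_contra! hno
  have hbig : ∀ n : ℕ, ∃ F : Finset Ω, F.card = n ∧ (F : Set Ω) ⊆ Y ∧
      ∀ x ∈ F, ∀ y ∈ F, x ≠ y → 2 * η ≤ D x y := by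
    intro n
    induction n with
    | zero => exact ⟨∅, by simp⟩
    | succ n ih =>
      obtain ⟨F, hcard, hFY, hF⟩ := ih
      obtain ⟨y, hyY, hy⟩ := not_subset.1 (hno F (hbound F hFY hF))
      simp only [mem_iUnion, mem_ofPred_eq, not_exists, not_lt] at hy
      have hyF : y ∉ F := fun h => by
        have := hy y h
        rw [hself] at this
        linarith
      refine ⟨insert y F, by rw [Finset.card_insert_of_notMem hyF, hcard], ?_, ?_⟩
      · rw [Finset.coe_insert]
        exact insert_subset hyY hFY
      · intro a ha b hb hab
        rw [Finset.mem_insert] at ha hb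
        rcases ha with rfl | ha <;> rcases hb with rfl | hb
        · exact absurd rfl hab
        · rw [hcomm]
          exact hy b hb
        · exact hy a ha
        · exact hF a ha b hb hab
  obtain ⟨F, hcard, hFY, hF⟩ := hbig (⌊1 / c⌋₊ + 1)
  have := hbound F hFY hF
  omega

/-! ### Vanishing of the metric entropy -/

/-- A measurable partition of the circle changes little under a small translation. -/
theorem tendsto_volume_ne_add {k : ℕ} {Q : UnitAddCircle → Fin k} (hQ : Measurable Q) :
    Tendsto (fun t : UnitAddCircle => volume {x | Q x ≠ Q (x + t)}) (𝓝 0) (𝓝 0) := by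
  have h1 : ∀ j : Fin k, Tendsto (fun t : UnitAddCircle =>
      volume (symmDiff ((fun x => x + t) ⁻¹' (Q ⁻¹' {j})) (Q ⁻¹' {j}))) (𝓝 0) (𝓝 0) := by
    intro j
    have hc : Continuous fun t : UnitAddCircle =>
        (⟨fun x => x + t, continuous_add_const t⟩ : C(UnitAddCircle, UnitAddCircle)) :=
      ContinuousMap.continuous_of_continuous_uncurry _ (continuous_snd.add continuous_fst)
    have := tendsto_measure_symmDiff_preimage_nhds_zero (μ := volume) (ν := volume) (hc.tendsto 0)
      (Eventually.of_forall fun t => measurePreserving_add_right volume t)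
      (measurePreserving_add_right volume 0)
      (hQ (measurableSet_singleton j)).nullMeasurableSet (measure_ne_top _ _)
    simpa using this
  have h2 : Tendsto (fun t : UnitAddCircle => ∑ j : Fin k,
      volume (symmDiff ((fun x => x + t) ⁻¹' (Q ⁻¹' {j})) (Q ⁻¹' {j}))) (𝓝 0) (𝓝 0) := by
    simpa using tendsto_finsetSum Finset.univ fun j _ => h1 j
  refine tendsto_of_tendsto_of_tendsto_of_le_of_le tendsto_const_nhds h2 (fun _ => zero_le)
    fun t => ?_
  refine (measure_mono ?_).trans (measure_biUnion_finset_le Finset.univ _)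
  intro x hx
  simp only [mem_iUnion]
  exact ⟨Q x, Finset.mem_univ _, Or.inr ⟨rfl, fun h => hx h.symm⟩⟩

/-- The Hamming distance between the orbits of `x` and `x + t` is on average the measure of
`{x | Q x ≠ Q (x + t)}`; this is Markov's inequality. -/
theorem volume_le_hammingDistance_add_le {k : ℕ} {Q : UnitAddCircle → Fin k} (hQ : Measurable Q)
    (θ t : UnitAddCircle) {n : ℕ} (hn : 1 ≤ n) (η : ℝ) :
    ENNReal.ofReal η * volume {x | η ≤ hammingDistance (· + θ) Q n x (x + t)} ≤
      volume {x | Q x ≠ Q (x + t)} := by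
  set E : Set UnitAddCircle := {x | Q x ≠ Q (x + t)} with hE
  have hEm : MeasurableSet E :=
    (measurableSet_eq_fun hQ (hQ.comp (measurable_add_const t))).compl
  have hn0 : (0 : ℝ) < n := by exact_mod_cast hn
  set g : UnitAddCircle → ℝ≥0∞ := fun x =>
    ∑ s ∈ Finset.range n, ((fun x => x + s • θ) ⁻¹' E).indicator 1 x with hg
  have hgm : ∀ s : ℕ, MeasurableSet ((fun x => x + s • θ) ⁻¹' E) :=
    fun s => measurable_add_const _ hEm
  have hint : ∫⁻ x, g x = n * volume E := by
    rw [hg, lintegral_finsetSum _ fun s _ => measurable_one.indicator (hgm s)]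
    simp only [lintegral_indicator_one (hgm _), measure_preimage_add_right]
    simp
  have hset : {x | η ≤ hammingDistance (· + θ) Q n x (x + t)} ⊆
      {x | ENNReal.ofReal (η * n) ≤ g x} := by
    intro x hx
    rw [mem_ofPred_eq, hammingDistance_eq _ _ hn, le_div_iff₀ hn0] at hx
    have : g x = ENNReal.ofReal
        ((Finset.range n).filter fun s => Q ((· + θ)^[s] x) ≠ Q ((· + θ)^[s] (x + t))).card := by
      rw [ENNReal.ofReal_natCast, Finset.card_filter]
      push_cast
      refine Finset.sum_congr rfl fun s _ => ?_
      simp only [add_right_iterate, add_right_comm x t]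
      by_cases h : Q (x + s • θ) ≠ Q (x + s • θ + t)
      · rw [if_pos h, indicator_of_mem (by exact h), Pi.one_apply]
      · rw [if_neg h, indicator_of_notMem (by exact h)]
    rw [mem_ofPred_eq, this]
    exact ENNReal.ofReal_le_ofReal hx
  have h1 := mul_meas_ge_le_lintegral (μ := volume)
    (Finset.measurable_fun_sum _ fun s _ => measurable_one.indicator (hgm s) : Measurable g)
    (ENNReal.ofReal (η * n))
  have h2 := (mul_le_mul_right (measure_mono hset) (ENNReal.ofReal (η * n))).trans h1
  rwa [hint, ENNReal.ofReal_mul' hn0.le, ENNReal.ofReal_natCast, mul_comm _ (n : ℝ≥0∞), mul_assoc,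
    ENNReal.mul_le_mul_iff_right (by simpa using by omega) (by simp)] at h2

/-- Most of the circle is covered by a number of Hamming balls that does not depend on `n`. There is
a neighbourhood `U` of `0` such that for every `t ∈ U` most `x` are close to `x + t`; by Fubini's
theorem, for most `x` the Hamming ball around `x` contains half of `x + U`. -/
theorem exists_hammingBall_cover {k : ℕ} {Q : UnitAddCircle → Fin k} (hQ : Measurable Q)
    (θ : UnitAddCircle) {ε : ℝ} (hε : 0 < ε) :
    ∃ C : ℕ, ∀ n : ℕ, 1 ≤ n → ∃ F : Finset UnitAddCircle, F.card ≤ C ∧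
      1 - ε < volume.real (⋃ x ∈ F, {y | hammingDistance (· + θ) Q n x y < ε}) := by
  set κ : ℝ≥0∞ := ENNReal.ofReal (ε / 8) with hκ
  set η : ℝ := ε / 2 with hη
  have hη0 : 0 < η := by positivity
  obtain ⟨U, hU, hUo, hU0⟩ : ∃ U : Set UnitAddCircle,
      (∀ t ∈ U, volume {x | Q x ≠ Q (x + t)} < ENNReal.ofReal η * κ) ∧ IsOpen U ∧ 0 ∈ U :=
    eventually_nhds_iff.1 ((tendsto_volume_ne_add hQ).eventually_lt_const (by positivity))
  set v : ℝ := volume.real U with hv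
  have hv0 : 0 < v := ENNReal.toReal_pos (hUo.measure_pos volume ⟨0, hU0⟩).ne' (measure_ne_top _ _)
  refine ⟨⌊1 / (v / 2)⌋₊, fun n hn => ?_⟩
  have hrot : Measurable (· + θ : UnitAddCircle → UnitAddCircle) := measurable_add_const θ
  -- The bad pairs `(x, t)`, and the measure `b x` of the bad translations at `x`.
  set B : Set (UnitAddCircle × UnitAddCircle) :=
    {p | p.2 ∈ U ∧ η ≤ hammingDistance (· + θ) Q n p.1 (p.1 + p.2)} with hB
  have hBm : MeasurableSet B :=
    (measurable_snd hUo.measurableSet).inter (measurableSet_le measurable_const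
      (measurable_hammingDistance hrot hQ n measurable_fst (measurable_fst.add measurable_snd)))
  set b : UnitAddCircle → ℝ≥0∞ := fun x => volume (Prod.mk x ⁻¹' B) with hb
  have hbint : ∫⁻ x, b x ≤ κ * ENNReal.ofReal v := by
    calc ∫⁻ x, b x = (volume.prod volume) B := (Measure.prod_apply hBm).symm
      _ = ∫⁻ t, volume ((fun x => (x, t)) ⁻¹' B) := Measure.prod_apply_symm hBm
      _ ≤ ∫⁻ t, U.indicator (fun _ => κ) t := by
        refine lintegral_mono fun t => ?_
        by_cases ht : t ∈ U
        · rw [indicator_of_mem ht]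
          have h1 := (volume_le_hammingDistance_add_le hQ θ t hn η).trans (hU t ht).le
          rw [ENNReal.mul_le_mul_iff_right (by simpa using hη0) (by simp)] at h1
          exact (measure_mono fun x hx => hx.2).trans h1
        · rw [indicator_of_notMem ht]
          refine (measure_mono_null (fun x hx => ?_) measure_empty).le
          exact ht hx.1
      _ = κ * ENNReal.ofReal v := by
        rw [lintegral_indicator_const hUo.measurableSet, hv, ofReal_measureReal]
  have hbm : Measurable b := measurable_measure_prodMk_left hBm
  set Y : Set UnitAddCircle := {x | b x < ENNReal.ofReal (v / 2)} with hYdef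
  have hYm : MeasurableSet Y := measurableSet_lt hbm measurable_const
  have hYc : volume.real Yᶜ ≤ ε / 4 := by
    have h1 := (mul_meas_ge_le_lintegral (μ := volume) hbm (ENNReal.ofReal (v / 2))).trans hbint
    have h2 : Yᶜ = {x | ENNReal.ofReal (v / 2) ≤ b x} := by
      ext x
      simp [hYdef]
    rw [← h2, ← ofReal_measureReal, hκ, ← ENNReal.ofReal_mul (by positivity),
      ← ENNReal.ofReal_mul (by positivity), ENNReal.ofReal_le_ofReal_iff (by positivity)] at h1
    have h3 : v * volume.real Yᶜ ≤ v * (ε / 4) := by linarith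
    exact le_of_mul_le_mul_left h3 hv0
  have hball : ∀ x ∈ Y, v / 2 ≤ volume.real {y | hammingDistance (· + θ) Q n x y < η} := by
    intro x hx
    have h1 : volume.real {y | hammingDistance (· + θ) Q n x y < η} =
        volume.real {t | hammingDistance (· + θ) Q n x (x + t) < η} :=
      congrArg ENNReal.toReal (measure_preimage_add volume x
        {y | hammingDistance (· + θ) Q n x y < η}).symm
    have h2 : U ⊆ {t | hammingDistance (· + θ) Q n x (x + t) < η} ∪ Prod.mk x ⁻¹' B := by
      intro t ht
      by_cases h : hammingDistance (· + θ) Q n x (x + t) < η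
      · exact Or.inl h
      · exact Or.inr ⟨ht, not_lt.1 h⟩
    have h3 := (measureReal_mono (μ := volume) h2).trans (measureReal_union_le _ _)
    have h4 : volume.real (Prod.mk x ⁻¹' B) ≤ v / 2 :=
      ENNReal.toReal_le_of_le_ofReal (by positivity) (show b x < _ from hx).le
    rw [h1]
    linarith
  obtain ⟨F, hF, hcover⟩ := exists_finset_cover_of_le_measureReal_ball volume
    (hammingDistance (· + θ) Q n) (hammingDistance_self _ Q hn) (hammingDistance_comm _ Q n)
    (hammingDistance_triangle _ Q hn)
    (fun x => measurable_hammingDistance hrot hQ n measurable_const measurable_id) hη0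
    (half_pos hv0) hball
  rw [hη, mul_div_cancel₀ ε two_ne_zero] at hcover
  refine ⟨F, hF, lt_of_lt_of_le ?_ (measureReal_mono hcover (measure_ne_top _ _))⟩
  rw [probReal_compl_eq_one_sub hYm] at hYc
  linarith

theorem metricSlowEntropy_eq_zero {u : ℤ → Bool} {α : ℝ} (h : HasSlope u α) (hα : Irrational α) :
    metricSlowEntropy polynomialScale (Measure.map (codingMap h hα) volume) (subshift u) = 0 := by
  classical
  refine le_antisymm (iSup_le fun k => iSup₂_le fun P hP => ?_) zero_le
  refine (limsup_le_of_le (h := ?_) : limsup _ _ ≤ (0 : ℝ≥0∞))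
  filter_upwards [self_mem_nhdsWithin] with ε hε
  have hc := measurable_codingMap h hα
  obtain ⟨C, hC⟩ := exists_hammingBall_cover (hP.comp hc) (α : UnitAddCircle) (mem_Ioi.1 hε)
  refine growthExponent_polynomialScale_le 0 C fun n hn => ?_
  obtain ⟨F, hF, hcover⟩ := hC n hn
  have hcard : (F.image (codingMap h hα)).card ≤ C := Finset.card_image_le.trans hF
  simp only [NNReal.coe_zero, Real.rpow_zero, mul_one, ENNReal.ofReal_natCast]
  refine (iInf₂_le (F.image (codingMap h hα)) ?_).trans (by exact_mod_cast hcard)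
  have hm : MeasurableSet (⋃ x ∈ F.image (codingMap h hα),
      {y | hammingDistance (subshift u) P n x y < ε}) :=
    Finset.measurableSet_biUnion _ fun x _ => measurableSet_lt
      (measurable_hammingDistance (measurable_subshift u) hP n measurable_const measurable_id)
      measurable_const
  refine hcover.trans_le (le_of_eq ?_)
  rw [map_measureReal_apply hc hm]
  congr 1
  ext z
  have key : ∀ x, hammingDistance (subshift u) P n (codingMap h hα x) (codingMap h hα z) =
      hammingDistance (· + (α : UnitAddCircle)) (P ∘ codingMap h hα) n x z := by
    intro x
    simp only [hammingDistance, iterate_subshift_codingMap, add_right_iterate, Function.comp]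
  simp [key]

end SlowEntropy

theorem mainTheorem3 (u : ℤ → Bool) (hu : SlowEntropy.IsSturmian u) :
    (∃! μ : ProbabilityMeasure (SlowEntropy.orbitClosure u),
      MeasurePreserving (SlowEntropy.subshift u) (μ : Measure _) (μ : Measure _)) ∧
    ∀ μ : ProbabilityMeasure (SlowEntropy.orbitClosure u),
      MeasurePreserving (SlowEntropy.subshift u) (μ : Measure _) (μ : Measure _) →
      0 = SlowEntropy.metricSlowEntropy SlowEntropy.polynomialScale (μ : Measure _)
            (SlowEntropy.subshift u) ∧
      SlowEntropy.metricSlowEntropy SlowEntropy.polynomialScale (μ : Measure _)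
            (SlowEntropy.subshift u) <
        SlowEntropy.semitopSlowEntropy SlowEntropy.polynomialScale (μ : Measure _)
            (SlowEntropy.subshift u) ∧
      SlowEntropy.semitopSlowEntropy SlowEntropy.polynomialScale (μ : Measure _)
            (SlowEntropy.subshift u) =
        SlowEntropy.topSlowEntropy SlowEntropy.polynomialScale (SlowEntropy.subshift u) ∧
      SlowEntropy.topSlowEntropy SlowEntropy.polynomialScale (SlowEntropy.subshift u) = 1 := by
  obtain ⟨α, h⟩ := hu.isBalanced.exists_hasSlope
  have hα := hu.isBalanced.irrational h hu.2
  refine ⟨SlowEntropy.existsUnique_invariant h hα, fun μ hμ => ?_⟩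
  have h0 := SlowEntropy.metricSlowEntropy_eq_zero h hα
  have h1 := SlowEntropy.one_le_semitopSlowEntropy h hα
  rw [← SlowEntropy.eq_map_codingMap h hα μ hμ] at h0 h1
  have h2 := SlowEntropy.semitopSlowEntropy_le_topSlowEntropy SlowEntropy.polynomialScale
    (μ : Measure _) (SlowEntropy.subshift u)
  have h3 := SlowEntropy.topSlowEntropy_le_one hu
  refine ⟨h0.symm, ?_, le_antisymm h2 (h3.trans h1), le_antisymm h3 (h1.trans h2)⟩
  rw [h0]
  exact zero_lt_one.trans_le h1
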